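/- **Setting.** Let $\mathbb K\in\{\mathbb R,\mathbb C\}$ and let $\mathfrak g$ be a finite-dimensional semisimple Lie algebra over $\mathbb K$ with Killing form $\langle\cdot,\cdot\rangle$. Loop algebra elements are formal series $X=\sum_n X_n\lambda^n$, $X_n\in\mathfrak g$, with finitely many positive powers of $\lambda$, with bracket $[X,Y]=\sum_n\big(\sum_{p+q=n}[X_p,Y_q]\big)\lambda^n$, residue pairing $\langle X,Y\rangle=\sum_{p+q=-1}\langle X_p,Y_q\rangle$, and projection $P_+$ onto the powers $\lambda^n$, $n\ge 0$. Let $N=\lim\mathbb R^n$ be the space of finitely supported real sequences $\mathbf a=(a_1,a_2,\dots)$; for $i\neq j$ and $\mathbf a\in N$ consider the plane $\mathbf a+N_{ij}$ in the directions $a_i,a_j$ (the slice $N_{ij}$ is the case $\mathbf a=0$). Given smooth fields $M_k:N\to\mathfrak g$, $k\ge 0$, put $$M^{(\infty)}=\sum_{k\ge0}M_k\lambda^{-k},\qquad M^{(i)}=P_+(\lambda^iM^{(\infty)})\quad(i\ge1),\qquad \mathsf M=\sum_{i\ge1} M^{(i)}da_i .$$ The zero curvature relation (ZCR) on $N_{ij}$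 is $\partial_{a_j}M^{(i)}-\partial_{a_i}M^{(j)}+[M^{(i)},M^{(j)}]=0$; the full ZCR $d^{\mathsf M}\mathsf M=0$ requires it for all $i,j$ at all points. The ZCR on $N_{i\infty}$ is $\partial_{a_i}M^{(\infty)}+[M^{(\infty)},M^{(i)}]=0$. The fields *vanish along $a_i$* if $M_k\to0$ as $a_i\to\pm\infty$ (other coordinates fixed) for every $k\ge1$ (no condition on $M_0$). A map $F$ *expresses the $M_k$ through $M^{(i)}$* if on every line in the direction $a_i$ the functions $(M_k)_{k\ge0}$ are the value of $F$ at the restriction of $M^{(i)}$ to that line; we then write $M_k(\cdot)$ for the components of $F(P_+\,\cdot)$ and $M^{(j)}(\cdot)=P_+\big(\lambda^j\sum_kM_k(\cdot)\lambda^{-k}\big)$, with arbitrary values of $F$ at functions that are not of the form just described. Functional derivatives are taken with respect to all component fields: $\delta h/\delta L=G$ means $\frac{d}{d\varepsilon}\big|_{0}h(L+\varepsilon v\lambda^k)=\int\langle G,v\lambda^k\rangle\,dx$ for all $k\in\mathbb Z$ and all smooth compactly supported $v:\mathbb R\to\mathfrak g$; $\delta l/\delta M=G$ means $\frac{d}{d\varepsilon}\big|_{0}\int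 l(M+\varepsilon v\lambda^k)\,dt=\iint\langle G,v\lambda^k\rangle\,dx\,dt$ for all $k\in\mathbb Z$ and all smooth compactly supported $v(t,x)$. The coefficients of $G$ are required to be smooth (in $x$ for $\delta h/\delta L$, jointly in $(t,x)$ for $\delta l/\delta M$). Let $c(\xi,\eta)=\int\langle\xi,\partial_x\eta\rangle\,dx$ be the derivative cocycle, and consider the central extension with bracket $[(\xi,b),(\eta,b')]=([\xi,\eta],c(\xi,\eta))$. The coadjoint motion of the momentum $(\mu,1)$ with velocity $\xi$ is $$\frac{d}{dt}\int\langle\mu,\eta\rangle\,dx=\int\langle\mu,[\eta,\xi]\rangle\,dx+c(\eta,\xi)\qquad\text{for all }\eta=v\lambda^k .$$ The Lie–Poisson equation of $h$ is this equation with $\mu=L$, $\xi=\delta h/\delta L$; the Euler–Poincaré equation of $l$ is this equation with $\mu=\delta l/\delta M$, $\xi=M$. **Theorem.** If $d^{\mathsf M}\mathsf M=0$, then the ZCR on $N_{i\infty}$ holds for every $i\ge1$. Moreover, for all $i\ne j$: 1. **Hamiltonian** ($x=a_i$, $t=a_j$, $L=M^{(i)}$). The ZCR on $N_{i\infty}$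 makes every $M_k$ a function of $L$: there is one map $F$ that expresses the $M_k$ through $M^{(i)}$ for all smooth families $(M_k)$ that vanish along $a_i$ and satisfy the ZCR on $N_{i\infty}$. Whenever $(M_k)$ is a smooth family that satisfies the ZCR on $N_{i\infty}$ and $F$ expresses the $M_k$ through $M^{(i)}$, put $h_j(L)=\int\langle L,M^{(j)}(L)\rangle\,dx$. Then on each plane $\mathbf a+N_{ij}$ the functional derivative $\delta h_j/\delta L$ along $L=M^{(i)}$ exists, is unique and equals $M^{(j)}$, and the following are equivalent: (a) the Lie–Poisson equation of $h_j$ for $L$; (b) $\partial_tL-\partial_x\frac{\delta h_j}{\delta L}=\big[\frac{\delta h_j}{\delta L},L\big]$; (c) the ZCR on $\mathbf a+N_{ij}$. 2. **Lagrangian** ($t=a_j$, $x=a_i$, $M=M^{(j)}$). The ZCR on $N_{j\infty}$ makes every $M_k$ a function of $M$: there is one map $F$ that expresses the $M_k$ through $M^{(j)}$ for all smooth families $(M_k)$ that vanish along $a_j$ and satisfy the ZCR on $N_{j\infty}$. Whenever $(M_k)$ is a smooth family that satisfies the ZCR on $N_{j\infty}$ and $F$ expresses the $M_k$ through $M^{(j)}$,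 put $l_i(M)=\int\langle M,M^{(i)}(M)\rangle\,dx$. Then on each plane $\mathbf a+N_{ij}$ the derivative $\delta l_i/\delta M$ along $M=M^{(j)}$ exists, is unique and equals $M^{(i)}$, and the following are equivalent: (a) the centrally extended Euler–Poincaré equation of $l_i$ for $M$; (b) $\partial_t\frac{\delta l_i}{\delta M}=\big[M,\frac{\delta l_i}{\delta M}\big]+\partial_xM$; (c) the ZCR on $\mathbf a+N_{ij}$. -/

import Mathlib

open Filter Topology MeasureTheory
open scoped ContDiff

/-- A Lie ring carrying a norm (with the same addition).  No compatibility of the norm with the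
bracket is asked for: it is automatic for finite-dimensional Lie algebras, on which all norms are
equivalent.  The norm only serves to make sense of derivatives and limits. -/
class NormedLieRing (𝔤 : Type*) extends NormedAddCommGroup 𝔤, LieRing 𝔤

/-- A Lie algebra over `𝕜` on a normed space (with the same scalar multiplication). -/
class NormedLieAlgebra (𝕜 : Type*) (𝔤 : Type*) [NormedField 𝕜] [NormedLieRing 𝔤]
  extends NormedSpace 𝕜 𝔤, LieAlgebra 𝕜 𝔤

/-! ### The loop algebra -/

/-- An element `∑ₙ Xₙ λⁿ` of the loop algebra, given by its Fourier coefficients. The elements that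
matter have powers of `λ` bounded above, see `Loop.IsBoundedAbove`, and possibly infinitely
many negative powers. -/
abbrev Loop (𝔤 : Type*) := ℤ → 𝔤

namespace Loop

variable {𝔤 : Type*}

/-- Only finitely many positive powers of `λ` occur. -/
def IsBoundedAbove [Zero 𝔤] (X : Loop 𝔤) : Prop := ∃ N : ℤ, ∀ n, N < n → X n = 0

/-- The bracket `[∑ Xₚ λᵖ, ∑ Y_q λ^q] = ∑ₙ (∑_{p+q=n} [Xₚ, Y_q]) λⁿ`; the inner sum is finite when
the powers of `λ` in `X` and `Y` are bounded above. -/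
noncomputable def bracket [LieRing 𝔤] (X Y : Loop 𝔤) : Loop 𝔤 :=
  fun n => ∑ᶠ p : ℤ, ⁅X p, Y (n - p)⁆

/-- The residue pairing `∑_{p+q=-1} ⟨Xₚ, Y_q⟩`, with `⟨·,·⟩` the Killing form. -/
noncomputable def pairing (𝕜 : Type*) [CommRing 𝕜] [LieRing 𝔤] [LieAlgebra 𝕜 𝔤]
    (X Y : Loop 𝔤) : 𝕜 :=
  ∑ᶠ p : ℤ, killingForm 𝕜 𝔤 (X p) (Y (-1 - p))

/-- Multiplication by `λⁱ`. -/
def shift (i : ℤ) (X : Loop 𝔤) : Loop 𝔤 := fun n => X (n - i)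

/-- The projection `P₊` onto the nonnegative powers of `λ`. -/
def posPart [Zero 𝔤] (X : Loop 𝔤) : Loop 𝔤 := fun n => if 0 ≤ n then X n else 0

/-- The monomial `v λᵏ`. -/
def mode [Zero 𝔤] (k : ℤ) (v : 𝔤) : Loop 𝔤 := fun n => if n = k then v else 0

/-- The element `∑_{k ≥ 0} mₖ λ⁻ᵏ`. -/
def ofCoeffs [Zero 𝔤] (m : ℕ → 𝔤) : Loop 𝔤 := fun n => if n ≤ 0 then m (-n).toNat else 0

/-- The polynomial `P₊(λⁱ ∑_{k ≥ 0} mₖ λ⁻ᵏ) = ∑_{k ≤ i} mₖ λⁱ⁻ᵏ`. -/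
def truncation [Zero 𝔤] (i : ℕ+) (m : ℕ → 𝔤) : Loop 𝔤 :=
  posPart (shift ((i : ℕ) : ℤ) (ofCoeffs m))

end Loop

/-! ### The multi-time space and the connection -/

/-- The multi-time space `N = lim ℝⁿ`, with coordinates `a₁, a₂, …`. -/
abbrev MultiTime := ℕ+ →₀ ℝ

/-- A field on `N = lim ℝⁿ` is smooth if it is smooth on each coordinate subspace of finite
dimension. -/
def IsSmoothField {𝔤 : Type*} [NormedAddCommGroup 𝔤] [NormedSpace ℝ 𝔤] (f : MultiTime → 𝔤) : Prop :=
  ∀ s : Finset ℕ+, ContDiff ℝ ∞ fun v : s → ℝ => f (∑ k : s, Finsupp.single (k : ℕ+) (v k))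

/-- The partial derivative `∂f/∂aᵢ`. -/
noncomputable def partialDeriv {𝔤 : Type*} [NormedAddCommGroup 𝔤] [NormedSpace ℝ 𝔤] (i : ℕ+)
    (f : MultiTime → 𝔤) (a : MultiTime) : 𝔤 :=
  deriv (fun s : ℝ => f (a + Finsupp.single i s)) 0

section Connection

variable {𝔤 : Type*} [NormedLieRing 𝔤]

/-- `M^{(∞)} = ∑_{k ≥ 0} Mₖ λ⁻ᵏ` for fields `M₀, M₁, …` on the multi-time space. -/
def connInfty (M : ℕ → MultiTime → 𝔤) (a : MultiTime) : Loop 𝔤 := Loop.ofCoeffs fun k => M k a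

/-- The component `M^{(i)} = P₊(λⁱ M^{(∞)})` of the connection `∑ᵢ M^{(i)} daᵢ`. -/
def conn (M : ℕ → MultiTime → 𝔤) (i : ℕ+) (a : MultiTime) : Loop 𝔤 :=
  Loop.truncation i fun k => M k a

variable [NormedSpace ℝ 𝔤]

/-- The component `∂_{a_j} M^{(i)} - ∂_{a_i} M^{(j)} + [M^{(i)}, M^{(j)}]` of the curvature. -/
noncomputable def curvature (M : ℕ → MultiTime → 𝔤) (i j : ℕ+) (a : MultiTime) : Loop 𝔤 :=
  fun n => partialDeriv j (fun b => conn M i b n) a - partialDeriv i (fun b => conn M j b n) a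
    + Loop.bracket (conn M i a) (conn M j a) n

/-- The zero curvature relation of the whole connection. -/
def ZeroCurvature (M : ℕ → MultiTime → 𝔤) : Prop := ∀ i j a, curvature M i j a = 0

/-- The zero curvature relation `∂_{a_i} M^{(∞)} + [M^{(∞)}, M^{(i)}] = 0` on `N_{i∞}`. -/
def ZeroCurvatureInfty (M : ℕ → MultiTime → 𝔤) (i : ℕ+) : Prop :=
  ∀ a n, partialDeriv i (fun b => connInfty M b n) a
    + Loop.bracket (connInfty M a) (conn M i a) n = 0

/-- The point with coordinates `aᵢ + x` and `a_j + t` of the plane `a + N_{ij}`. -/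
noncomputable def slicePoint (a : MultiTime) (i j : ℕ+) (x t : ℝ) : MultiTime :=
  a + Finsupp.single i x + Finsupp.single j t

/-- The zero curvature relation on the plane `a + N_{ij}`, that is, flatness of the restricted
connection `M^{(i)} daᵢ + M^{(j)} da_j`. -/
def ZeroCurvatureOnSlice (M : ℕ → MultiTime → 𝔤) (i j : ℕ+) (a : MultiTime) : Prop :=
  ∀ x t : ℝ, curvature M i j (slicePoint a i j x t) = 0

/-- Vanishing boundary conditions in the direction `aᵢ`: all fields but the leading coefficient
`M₀` tend to `0` as `aᵢ → ±∞`. -/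
def VanishesAlong (M : ℕ → MultiTime → 𝔤) (i : ℕ+) : Prop :=
  ∀ k : ℕ, 1 ≤ k → ∀ a : MultiTime,
    Tendsto (fun s : ℝ => M k (a + Finsupp.single i s)) (cocompact ℝ) (𝓝 0)

/-- The map `F` expresses all the fields `Mₖ`, on each line in the direction `aᵢ`, as a function of
the restriction of `M^{(i)}` to that line. -/
def ExpressesThrough (F : (ℝ → Loop 𝔤) → ℕ → ℝ → 𝔤) (M : ℕ → MultiTime → 𝔤) (i : ℕ+) : Prop :=
  ∀ a : MultiTime, F (fun s => conn M i (a + Finsupp.single i s))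
    = fun k s => M k (a + Finsupp.single i s)

end Connection

/-! ### The central extension by the derivative cocycle -/

section Mechanics

variable (𝕜 : Type*) {𝔤 : Type*} [RCLike 𝕜] [NormedLieRing 𝔤] [NormedLieAlgebra 𝕜 𝔤]

/-- A smooth `𝔤`-valued function with compact support. -/
def IsTestFunction {E : Type*} [NormedAddCommGroup E] [NormedSpace ℝ E] [NormedSpace ℝ 𝔤]
    (v : E → 𝔤) : Prop := ContDiff ℝ ∞ v ∧ HasCompactSupport v

/-- The derivative cocycle `c(ξ, η) = ∫ ⟨ξ, ∂ₓη⟩ dx`. -/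
noncomputable def cocycle [NormedSpace ℝ 𝔤] (ξ η : ℝ → Loop 𝔤) : 𝕜 :=
  ∫ x, Loop.pairing 𝕜 (ξ x) (fun n => deriv (fun y => η y n) x)

/-- The bracket `[(ξ, b), (η, c)] = ([ξ, η], c(ξ, η))` of the central extension. -/
noncomputable def extBracket [NormedSpace ℝ 𝔤] (X Y : (ℝ → Loop 𝔤) × 𝕜) : (ℝ → Loop 𝔤) × 𝕜 :=
  (fun x => Loop.bracket (X.1 x) (Y.1 x), cocycle 𝕜 X.1 Y.1)

/-- The pairing `∫ ⟨μ, ξ⟩ dx + m b` of `(μ, m)` and `(ξ, b)`, by which the centrally extended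
algebra is identified with its dual. -/
noncomputable def extPairing (μ ξ : (ℝ → Loop 𝔤) × 𝕜) : 𝕜 :=
  (∫ x, Loop.pairing 𝕜 (μ.1 x) (ξ.1 x)) + μ.2 * ξ.2

/-- The coadjoint motion in the centrally extended algebra of the momentum `(μ, 1)` with velocity
`(ξ, 0)`: `d/dt ⟨(μ, 1), (η, 0)⟩ = ⟨(μ, 1), [(η, 0), (ξ, 0)]⟩` for all test fields `η`.
For `ξ = δh/δμ` the right-hand side is the Lie–Poisson bracket `{⟨·, η⟩, h}`. The first argument
of `μ` and `ξ` is the time, the second one the space variable. -/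
def CoadjointMotion [NormedSpace ℝ 𝔤] (μ ξ : ℝ → ℝ → Loop 𝔤) : Prop :=
  ∀ (k : ℤ) (v : ℝ → 𝔤), IsTestFunction v → ∀ t : ℝ,
    HasDerivAt (fun τ => extPairing 𝕜 (μ τ, 1) (fun x => Loop.mode k (v x), 0))
      (extPairing 𝕜 (μ t, 1) (extBracket 𝕜 (fun x => Loop.mode k (v x), 0) (ξ t, 0))) t

/-! ### Hamiltonian side -/

/-- `G = δh/δL` for a functional `h` of the component fields `L_k(x)` of `L = ∑ₖ L_k λᵏ`:
`d/dε h(L + ε v λᵏ) = ∫ ⟨G, v λᵏ⟩ dx` for every test function `v` and every power `k` of `λ`. -/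
def IsFunctionalDeriv [NormedSpace ℝ 𝔤] (h : (ℝ → Loop 𝔤) → 𝕜) (L G : ℝ → Loop 𝔤) : Prop :=
  ∀ (k : ℤ) (v : ℝ → 𝔤), IsTestFunction v →
    HasDerivAt (fun ε : ℝ => h fun x => L x + (ε : 𝕜) • Loop.mode k (v x))
      (∫ x, Loop.pairing 𝕜 (G x) (Loop.mode k (v x))) 0

/-- The functional `h_j(L) = ∫ ⟨L, M^{(j)}(L)⟩ dx`, where `M^{(j)}(L) = P₊(λʲ ∑ₖ Mₖ(L) λ⁻ᵏ)` and
the functions `Mₖ(L) = F(P₊L)ₖ` are given by `F`. -/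
noncomputable def hamiltonian (F : (ℝ → Loop 𝔤) → ℕ → ℝ → 𝔤) (j : ℕ+) (L : ℝ → Loop 𝔤) : 𝕜 :=
  ∫ x, Loop.pairing 𝕜 (L x) (Loop.truncation j fun k => F (fun y => Loop.posPart (L y)) k x)

/-- `G` is a velocity field along `L(t, x)`: at all times it is the functional derivative `δh/δL`,
with coefficients that are smooth in `x`. -/
def IsVelocity [NormedSpace ℝ 𝔤] (h : (ℝ → Loop 𝔤) → 𝕜) (L G : ℝ → ℝ → Loop 𝔤) : Prop :=
  (∀ t x, (G t x).IsBoundedAbove) ∧ (∀ t n, ContDiff ℝ ∞ fun x => G t x n) ∧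
    ∀ t, IsFunctionalDeriv 𝕜 h (L t) (G t)

/-- The Lie–Poisson equation on the dual of the centrally extended algebra. -/
def LiePoisson [NormedSpace ℝ 𝔤] (h : (ℝ → Loop 𝔤) → 𝕜) (L : ℝ → ℝ → Loop 𝔤) : Prop :=
  ∃ G, IsVelocity 𝕜 h L G ∧ CoadjointMotion 𝕜 L G

/-- The Lie–Poisson equation, `∂ₜL - ∂ₓ δh/δL = ad_{δh/δL} L`. -/
def LiePoissonPDE [NormedSpace ℝ 𝔤] (h : (ℝ → Loop 𝔤) → 𝕜) (L : ℝ → ℝ → Loop 𝔤) : Prop :=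
  ∃ G, IsVelocity 𝕜 h L G ∧ ∀ t x n,
    deriv (fun τ => L τ x n) t - deriv (fun y => G t y n) x = Loop.bracket (G t x) (L t x) n

/-! ### Lagrangian side -/

/-- `G = δl/δM` for a Lagrangian `l`, which takes a field `M(t, x)` to a function of `t`:
`d/dε ∫ l(M + ε v λᵏ) dt = ∬ ⟨G, v λᵏ⟩ dx dt` for every test function `v(t, x)` and every power `k`
of `λ`. -/
def IsLagrangianDeriv [NormedSpace ℝ 𝔤] (l : (ℝ → ℝ → Loop 𝔤) → ℝ → 𝕜)
    (M G : ℝ → ℝ → Loop 𝔤) : Prop :=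
  ∀ (k : ℤ) (v : ℝ × ℝ → 𝔤), IsTestFunction v →
    HasDerivAt (fun ε : ℝ => ∫ t, l (fun τ x => M τ x + (ε : 𝕜) • Loop.mode k (v (τ, x))) t)
      (∫ t, ∫ x, Loop.pairing 𝕜 (G t x) (Loop.mode k (v (t, x)))) 0

/-- The Lagrangian `l_i(M) = ∫ ⟨M, M^{(i)}(M)⟩ dx`, where `M^{(i)}(M) = P₊(λⁱ ∑ₖ Mₖ(M) λ⁻ᵏ)` and
the functions `Mₖ(M) = F(P₊M)ₖ` are given by `F`, which acts on functions of `t`. -/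
noncomputable def lagrangian (F : (ℝ → Loop 𝔤) → ℕ → ℝ → 𝔤) (i : ℕ+) (M : ℝ → ℝ → Loop 𝔤)
    (t : ℝ) : 𝕜 :=
  ∫ x, Loop.pairing 𝕜 (M t x)
    (Loop.truncation i fun k => F (fun τ => Loop.posPart (M τ x)) k t)

/-- `G` is a momentum field along `M(t, x)`: it is the derivative `δl/δM`, with smooth
coefficients. -/
def IsMomentum [NormedSpace ℝ 𝔤] (l : (ℝ → ℝ → Loop 𝔤) → ℝ → 𝕜) (M G : ℝ → ℝ → Loop 𝔤) : Prop :=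
  (∀ t x, (G t x).IsBoundedAbove) ∧ (∀ n, ContDiff ℝ ∞ fun p : ℝ × ℝ => G p.1 p.2 n) ∧
    IsLagrangianDeriv 𝕜 l M G

/-- The Euler–Poincaré equation on the dual of the centrally extended algebra. -/
def EulerPoincare [NormedSpace ℝ 𝔤] (l : (ℝ → ℝ → Loop 𝔤) → ℝ → 𝕜) (M : ℝ → ℝ → Loop 𝔤) : Prop :=
  ∃ G, IsMomentum 𝕜 l M G ∧ CoadjointMotion 𝕜 G M

/-- The Euler–Poincaré equation, `∂ₜ δl/δM = ad_M δl/δM + ∂ₓM`. -/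
def EulerPoincarePDE [NormedSpace ℝ 𝔤] (l : (ℝ → ℝ → Loop 𝔤) → ℝ → 𝕜)
    (M : ℝ → ℝ → Loop 𝔤) : Prop :=
  ∃ G, IsMomentum 𝕜 l M G ∧ ∀ t x n,
    deriv (fun τ => G τ x n) t = Loop.bracket (M t x) (G t x) n + deriv (fun y => M t y n) x

end Mechanics

/-!
The zero curvature relation on `N_{i∞}` is the limit `j → ∞` of the relations on `N_{ij}`: the
coefficient of `λ^{j-k}` of the latter no longer depends on `j` once `j - k > i`
(`ZeroCurvature.infty`).

The heart of the matter is that on a line in the direction `aᵢ` the polynomial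
`M^{(i)} = P₊(λⁱ M^{(∞)})` determines `X = M^{(∞)}`, for fields with vanishing boundary conditions
(`IsDecayingSolution.eq_of_head_eq`). No assumption on the leading coefficient `M₀` is needed. Put
`z = λ⁻¹` and `U = M^{(i)}`. The relation is the Lax equation `∂X = [U, X]`, and as `zⁱ U` is the
part of `X` of degree at most `i`, it is also of the form `∂X = [X, V]` with a power series `V` in
`z`. Hence the characteristic polynomial of `ad X` over the power series in `z` is constant along
the line: this is conjugation by `1 - ε V` over the dual numbers (`charpoly_eq_charpoly_lim`). Its
limit at infinity is the characteristic polynomial `χ` of `ad M₀`, with coefficients in the base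
field. If two solutions have the same `U`, their difference `D` solves `∂D = [U, D]`. Let `D_N` be
its leading coefficient, of order `N > i`. Since `zⁱ U` agrees with `X` up to order `i`, the series
`[X, D]` starts with `∂D_N z^{N+i}`, and it solves the same equation; by iteration `(ad X)^r D`
starts with `∂ʳ D_N z^{N+ir}`. The lowest term of `χ(ad X) D = 0` now reads `∂ˢ D_N = 0`, where
`s` is the order of `χ` at `0`. All the `∂ʳ D_N` tend to zero, being coefficients of `(ad X)^r D`,
so that `D_N = 0`.

The functional derivatives are then immediate (`pairing_variation`): polynomials in `λ` pair to
zero, so that variations along `λᵏ`, `k ≥ 0`, do not change `h_j` or `lᵢ`, while variations along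
negative powers do not change the fields `Mₖ` and enter linearly. In both formulations the
momentum is `M^{(i)}` and the velocity is `M^{(j)}`, and coadjoint motion, tested against all
`v λᵏ`, is the equation `∂ₜμ = [ξ, μ] + ∂ₓξ` (`coadjointMotion_iff`), that is, the zero curvature
relation.
-/

/-! ### Lie series in `z = λ⁻¹` -/

namespace LieSeries

open Finset Finset.Nat

section Ring

variable {L : Type*} [LieRing L]

/-- The bracket `[∑ Xₚ zᵖ, ∑ Y_q z^q]` of formal power series with coefficients in a Lie ring,
given by their sequences of coefficients. -/
def conv (X Y : ℕ → L) : ℕ → L := fun n => ∑ p ∈ antidiagonal n, ⁅X p.1, Y p.2⁆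

/-- The polynomial `∑_{k ≤ i} Xₖ zᵏ`. -/
def head (i : ℕ) (X : ℕ → L) : ℕ → L := fun n => if n ≤ i then X n else 0

lemma conv_sub (X Y Z : ℕ → L) : conv X (Y - Z) = conv X Y - conv X Z := by
  funext n; simp [conv, sum_sub_distrib]

lemma conv_skew (X Y : ℕ → L) (n : ℕ) : -conv Y X n = conv X Y n := by
  simp only [conv, ← sum_neg_distrib, lie_skew]
  exact sum_antidiagonal_swap (f := fun p : ℕ × ℕ => ⁅X p.1, Y p.2⁆)

lemma conv_congr {X X' Y Y' : ℕ → L} {n : ℕ} (hX : ∀ k ≤ n, X k = X' k)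
    (hY : ∀ k ≤ n, Y k = Y' k) : conv X Y n = conv X' Y' n := by
  refine sum_congr rfl fun p hp => ?_
  have := HasAntidiagonal.mem_antidiagonal.mp hp
  rw [hX _ (by omega), hY _ (by omega)]

/-- The Jacobi identity, in Leibniz form. -/
lemma conv_conv (W X Z : ℕ → L) :
    conv W (conv X Z) = conv (conv W X) Z + conv X (conv W Z) := by
  funext n
  have assoc (f : ℕ → ℕ → ℕ → L) :
      ∑ p ∈ antidiagonal n, ∑ q ∈ antidiagonal p.2, f p.1 q.1 q.2 =
        ∑ p ∈ antidiagonal n, ∑ q ∈ antidiagonal p.1, f q.1 q.2 p.2 := by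
    rw [sum_sigma', sum_sigma']
    refine sum_nbij' (fun x => ⟨(x.1.1 + x.2.1, x.2.2), (x.1.1, x.2.1)⟩)
      (fun x => ⟨(x.2.1, x.2.2 + x.1.2), (x.2.2, x.1.2)⟩) ?_ ?_ ?_ ?_ ?_ <;>
    · simp only [mem_sigma, HasAntidiagonal.mem_antidiagonal]
      rintro ⟨⟨a, b⟩, ⟨c, d⟩⟩ ⟨h1, h2⟩
      dsimp only at h1 h2
      subst h1 h2
      simp [add_assoc]
  have h1 : conv W (conv X Z) n = ∑ p ∈ antidiagonal n, ∑ q ∈ antidiagonal p.2,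
      (⁅⁅W p.1, X q.1⁆, Z q.2⁆ + ⁅X q.1, ⁅W p.1, Z q.2⁆⁆) := by
    simp only [conv, lie_sum, ← leibniz_lie]
  have h2 : conv (conv W X) Z n =
      ∑ p ∈ antidiagonal n, ∑ q ∈ antidiagonal p.1, ⁅⁅W q.1, X q.2⁆, Z p.2⁆ := by
    simp only [conv, sum_lie]
  have h3 : conv X (conv W Z) n =
      ∑ p ∈ antidiagonal n, ∑ q ∈ antidiagonal p.2, ⁅X p.1, ⁅W q.1, Z q.2⁆⁆ := by
    simp only [conv, lie_sum]
  rw [Pi.add_apply, h1, h2, h3]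
  simp only [sum_add_distrib]
  rw [assoc fun a b c => ⁅⁅W a, X b⁆, Z c⁆, assoc fun a b c => ⁅X b, ⁅W a, Z c⁆⁆,
    assoc fun a b c => ⁅X a, ⁅W b, Z c⁆⁆]
  congr 1
  refine sum_congr rfl fun p _ => ?_
  exact (sum_antidiagonal_swap (f := fun q : ℕ × ℕ => ⁅X q.2, ⁅W q.1, Z p.2⁆⁆)).symm

lemma conv_eq_zero_of_lt {X Z : ℕ → L} {N : ℕ} (hZ : ∀ k < N, Z k = 0) {n : ℕ} (hn : n < N) :
    conv X Z n = 0 :=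
  sum_eq_zero fun p hp => by
    have := HasAntidiagonal.mem_antidiagonal.mp hp
    rw [hZ _ (by omega), lie_zero]

/-- If `Z` has order at least `N`, then `[X, Z]` and `[head i X, Z]` agree up to order `N + i`. -/
lemma conv_head_of_le {X Z : ℕ → L} {N : ℕ} (hZ : ∀ k < N, Z k = 0) {i n : ℕ}
    (hn : n ≤ N + i) : conv (head i X) Z n = conv X Z n := by
  refine sum_congr rfl fun p hp => ?_
  rw [HasAntidiagonal.mem_antidiagonal] at hp
  by_cases h : p.1 ≤ i
  · simp [head, h]
  · rw [hZ p.2 (by omega), lie_zero, lie_zero]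

lemma _root_.NormedLieRing.isAddTorsionFree (𝔤 : Type*) [NormedLieRing 𝔤] [NormedSpace ℝ 𝔤] :
    IsAddTorsionFree 𝔤 := .of_isTorsionFree ℝ 𝔤

lemma conv_self (X : ℕ → L) [IsAddTorsionFree L] (n : ℕ) : conv X X n = 0 :=
  self_eq_neg.mp (conv_skew X X n).symm

/-- If `Y` has order at least `i`, then `[Y, X] = zⁱ [z⁻ⁱ Y, X]`. -/
lemma conv_shift_left {Y : ℕ → L} {i : ℕ} (hY : ∀ k < i, Y k = 0) (X : ℕ → L) (k : ℕ) :
    conv Y X (k + i) = conv (fun p => Y (p + i)) X k := by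
  rw [conv, conv, sum_antidiagonal_eq_sum_range_succ_mk, sum_antidiagonal_eq_sum_range_succ_mk,
    show (k + i).succ = i + k.succ by omega, sum_range_add, sum_eq_zero, zero_add]
  · refine sum_congr rfl fun p _ => ?_
    rw [add_comm i p, show k + i - (p + i) = k - p by omega]
  · intro p hp
    rw [hY p (mem_range.mp hp), zero_lie]

/-- If `Y` has order at least `i`, then `[X, Y] = zⁱ [X, z⁻ⁱ Y]`. -/
lemma conv_shift_right {Y : ℕ → L} {i : ℕ} (hY : ∀ k < i, Y k = 0) (X : ℕ → L) (k : ℕ) :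
    conv X Y (k + i) = conv X (fun p => Y (p + i)) k := by
  rw [← conv_skew, conv_shift_left hY, conv_skew]

lemma head_of_le {i k : ℕ} (X : ℕ → L) (h : k ≤ i) : head i X k = X k := if_pos h

lemma conv_head_self (X : ℕ → L) [IsAddTorsionFree L] {i n : ℕ} (hn : n ≤ i) :
    conv (head i X) X n = 0 := by
  rw [← conv_self X n]
  exact conv_congr (fun k hk => head_of_le X (hk.trans hn)) fun _ _ => rfl

end Ring

end LieSeries

namespace Loop

open LieSeries Finset Finset.Nat

variable {L : Type*} [LieRing L]

/-- The coefficients of a bracket of loops whose powers of `λ` are bounded by `N` and `N'`. -/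
lemma bracket_eq_conv {X Y : Loop L} {N N' : ℤ} (hX : ∀ n, N < n → X n = 0)
    (hY : ∀ n, N' < n → Y n = 0) (k : ℕ) :
    bracket X Y (N + N' - k) = conv (fun p => X (N - p)) (fun q => Y (N' - q)) k := by
  rw [bracket, conv, finsum_eq_sum_of_support_subset (s := (range (k + 1)).image
    fun p : ℕ => N - (p : ℤ)), sum_image (by intro a _ b _ h; simpa using h),
    sum_antidiagonal_eq_sum_range_succ_mk]
  · refine sum_congr rfl fun p hp => ?_
    rw [mem_range] at hp
    congr 2
    push_cast [Nat.lt_succ_iff.mp hp]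
    ring
  · intro p hp
    rw [Function.mem_support] at hp
    have h1 : p ≤ N := by
      by_contra! h
      exact hp (by rw [hX p h, zero_lie])
    have h2 : N + N' - k - p ≤ N' := by
      by_contra! h
      exact hp (by rw [hY _ h, lie_zero])
    simp only [coe_image, Set.mem_image, mem_coe, mem_range]
    exact ⟨(N - p).toNat, by omega, by omega⟩

lemma bracket_eq_zero {X Y : Loop L} {N N' : ℤ} (hX : ∀ n, N < n → X n = 0)
    (hY : ∀ n, N' < n → Y n = 0) {n : ℤ} (hn : N + N' < n) : bracket X Y n = 0 := by
  refine finsum_eq_zero_of_forall_eq_zero fun p => ?_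
  by_cases h : N < p
  · rw [hX p h, zero_lie]
  · rw [hY (n - p) (by omega), lie_zero]

lemma bracket_skew (X Y : Loop L) (n : ℤ) : -bracket Y X n = bracket X Y n := by
  rw [bracket, bracket, ← finsum_neg_distrib, ← finsum_comp_equiv (Equiv.subLeft n)]
  simp [lie_skew]

lemma ofCoeffs_of_pos (m : ℕ → L) {n : ℤ} (hn : 0 < n) : ofCoeffs m n = 0 :=
  if_neg (by omega)

lemma ofCoeffs_neg (m : ℕ → L) (k : ℕ) : ofCoeffs m (0 - k) = m k := by
  simp [ofCoeffs]

lemma truncation_of_lt (m : ℕ → L) (i : ℕ+) {n : ℤ} (hn : ((i : ℕ) : ℤ) < n) :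
    truncation i m n = 0 := by
  simp only [truncation, posPart, shift]
  rw [ofCoeffs_of_pos m (by omega), ite_self]

lemma truncation_of_neg (m : ℕ → L) (i : ℕ+) {n : ℤ} (hn : n < 0) : truncation i m n = 0 :=
  if_neg (by omega)

/-- In `z = λ⁻¹`, the polynomial `P₊(λⁱ ∑ₖ mₖ λ⁻ᵏ)` is `z⁻ⁱ` times the head of the series. -/
lemma truncation_sub (m : ℕ → L) (i : ℕ+) (k : ℕ) :
    truncation i m (((i : ℕ) : ℤ) - k) = head i m k := by
  simp only [truncation, posPart, shift, head]
  rw [show ((i : ℕ) : ℤ) - k - ((i : ℕ) : ℤ) = 0 - k by ring, ofCoeffs_neg]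
  exact if_congr (by omega) rfl rfl

end Loop

section ZeroCurvature

open LieSeries Loop

variable {𝔤 : Type*} [NormedLieRing 𝔤]

lemma bracket_connInfty_conn (M : ℕ → MultiTime → 𝔤) (i : ℕ+) (a : MultiTime) (k : ℕ) :
    bracket (connInfty M a) (conn M i a) ((i : ℕ) - k) =
      -conv (head i fun p => M p a) (fun p => M p a) k := by
  have h := bracket_eq_conv (X := connInfty M a) (Y := conn M i a) (N := 0) (N' := (i : ℕ))
    (fun n hn => ofCoeffs_of_pos _ hn) (fun n hn => truncation_of_lt _ i hn) k
  simp only [connInfty, conn, ofCoeffs_neg, truncation_sub, zero_add] at h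
  rw [conv_skew]
  exact h

lemma connInfty_neg (M : ℕ → MultiTime → 𝔤) (a : MultiTime) (k : ℕ) :
    connInfty M a (-k) = M k a := by
  rw [← zero_sub]; exact ofCoeffs_neg _ k

variable [NormedSpace ℝ 𝔤]

/-- The relation on `N_{i∞}` in terms of the series `M^{(∞)}` in `z = λ⁻¹`. The equations of the
positive powers of `λ` hold by antisymmetry. -/
lemma zeroCurvatureInfty_iff (M : ℕ → MultiTime → 𝔤) (i : ℕ+) :
    ZeroCurvatureInfty M i ↔ ∀ a k, partialDeriv i (M k) a =
      conv (head i fun p => M p a) (fun p => M p a) (k + i) := by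
  have := NormedLieRing.isAddTorsionFree 𝔤
  have key (a : MultiTime) (k : ℕ) : (partialDeriv i (fun b => connInfty M b (-k)) a
      + bracket (connInfty M a) (conn M i a) (-k) = 0) ↔ partialDeriv i (M k) a =
      conv (head i fun p => M p a) (fun p => M p a) (k + i) := by
    have h := bracket_connInfty_conn M i a (k + i)
    rw [show ((i : ℕ) : ℤ) - ((k + i : ℕ) : ℤ) = -k by push_cast; ring] at h
    rw [h, ← sub_eq_add_neg, sub_eq_zero]
    simp only [connInfty_neg]
  refine ⟨fun h a k => (key a k).mp (h a _), fun h a n => ?_⟩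
  rcases le_or_gt n 0 with hn | hn
  · obtain ⟨k, rfl⟩ := Int.exists_eq_neg_ofNat hn
    exact (key a k).mpr (h a k)
  · have h0 : (fun b => connInfty M b n) = fun _ => 0 := by
      funext b; exact ofCoeffs_of_pos _ hn
    have h1 : bracket (connInfty M a) (conn M i a) n = 0 := by
      rcases le_or_gt n ((i : ℕ) : ℤ) with hi | hi
      · have h := bracket_connInfty_conn M i a ((i : ℕ) - n : ℤ).toNat
        rw [show ((i : ℕ) : ℤ) - (((i : ℕ) - n : ℤ).toNat : ℤ) = n by omega,
          conv_head_self _ (by omega), neg_zero] at h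
        exact h
      · exact bracket_eq_zero (N := 0) (N' := (i : ℕ)) (fun n hn => ofCoeffs_of_pos _ hn)
          (fun n hn => truncation_of_lt _ i hn) (by omega)
    rw [h0, h1]
    simp [partialDeriv]

/-- The relation on `N_{i∞}` is the stable part of the relations on `N_{ij}`: the coefficient of
`λ^{i+1}` of the latter, for `j = k + i + 1`, is the coefficient of `λ⁻ᵏ` of the former. -/
lemma ZeroCurvature.infty {M : ℕ → MultiTime → 𝔤} (h : ZeroCurvature M) (i : ℕ+) :
    ZeroCurvatureInfty M i := by
  rw [zeroCurvatureInfty_iff]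
  intro a k
  let j : ℕ+ := ⟨k + i + 1, by omega⟩
  have hj : ((j : ℕ) : ℤ) = k + (i : ℕ) + 1 := by simp [j]
  have hc := congrFun (h i j a) (((i : ℕ) : ℤ) + 1)
  have h1 : (fun b => conn M i b (((i : ℕ) : ℤ) + 1)) = fun _ => 0 := by
    funext b; exact truncation_of_lt _ i (by omega)
  have h2 : (fun b => conn M j b (((i : ℕ) : ℤ) + 1)) = M k := by
    funext b
    have := truncation_sub (fun p => M p b) j k
    rw [show ((j : ℕ) : ℤ) - k = (i : ℕ) + 1 by omega, head_of_le _ (by omega)] at this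
    exact this
  have h3 := bracket_eq_conv (X := conn M i a) (Y := conn M j a) (N := (i : ℕ)) (N' := (j : ℕ))
    (fun n hn => truncation_of_lt _ i hn) (fun n hn => truncation_of_lt _ j hn) (k + i)
  rw [show ((i : ℕ) : ℤ) + (j : ℕ) - ((k + i : ℕ) : ℤ) = (i : ℕ) + 1 by push_cast; omega] at h3
  simp only [curvature, h1, h2, h3, Pi.zero_apply] at hc
  simp only [conn, truncation_sub] at hc
  have h4 : conv (head i fun p => M p a) (head j fun p => M p a) (k + i) =
      conv (head i fun p => M p a) (fun p => M p a) (k + i) :=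
    conv_congr (fun _ _ => rfl) fun q hq => head_of_le _ (by omega)
  have h5 : partialDeriv j (fun _ => (0 : 𝔤)) a = 0 := by simp [partialDeriv]
  rw [h4, h5, zero_sub, neg_add_eq_zero] at hc
  exact hc

end ZeroCurvature

/-! ### Isospectrality -/

section Isospectral

open PowerSeries Matrix

variable {𝕜 : Type*} [RCLike 𝕜]

/-- The ring of differentiable functions with a limit at `+∞`, each paired with its limit. -/
def convergentFunctions (𝕜 : Type*) [RCLike 𝕜] : Subring ((ℝ → 𝕜) × 𝕜) where
  carrier := {f | Differentiable ℝ f.1 ∧ Tendsto f.1 atTop (𝓝 f.2)}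
  mul_mem' hf hg := ⟨hf.1.mul hg.1, hf.2.mul hg.2⟩
  add_mem' hf hg := ⟨hf.1.add hg.1, hf.2.add hg.2⟩
  neg_mem' hf := ⟨hf.1.neg, hf.2.neg⟩
  one_mem' := ⟨differentiable_const 1, tendsto_const_nhds⟩
  zero_mem' := ⟨differentiable_const 0, tendsto_const_nhds⟩

namespace convergentFunctions

/-- Evaluation at a point. -/
def eval (x : ℝ) : convergentFunctions 𝕜 →+* 𝕜 :=
  (Pi.evalRingHom _ x).comp ((RingHom.fst _ _).comp (convergentFunctions 𝕜).subtype)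

/-- The limit at `+∞`. -/
def lim : convergentFunctions 𝕜 →+* 𝕜 := (RingHom.snd _ _).comp (convergentFunctions 𝕜).subtype

/-- The `1`-jet `f(x) + ε f'(x)` at a point. -/
noncomputable def jet (x : ℝ) : convergentFunctions 𝕜 →+* DualNumber 𝕜 where
  toFun f := .inl (f.1.1 x) + .inr (deriv f.1.1 x)
  map_one' := TrivSqZeroExt.ext (by simp) (by simp)
  map_zero' := TrivSqZeroExt.ext (by simp) (by simp)
  map_add' f g := TrivSqZeroExt.ext (by simp) (by simpa using deriv_add (f.2.1 x) (g.2.1 x))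
  map_mul' f g := TrivSqZeroExt.ext (by simp) <| by
    simpa [add_comm, mul_comm] using deriv_mul (f.2.1 x) (g.2.1 x)

lemma jet_apply (x : ℝ) (f : convergentFunctions 𝕜) :
    jet x f = .inl (f.1.1 x) + .inr (deriv f.1.1 x) := rfl

lemma eval_eq_lim {f : convergentFunctions 𝕜} (h : ∀ x, (jet x f).snd = 0) (x : ℝ) :
    eval x f = lim f := by
  have hc : ∀ y, f.1.1 y = f.1.1 x := fun y =>
    is_const_of_deriv_eq_zero f.2.1 (fun z => by simpa [jet_apply] using h z) y x
  refine tendsto_nhds_unique (tendsto_const_nhds.congr fun y => (hc y).symm) f.2.2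

end convergentFunctions

variable {ι : Type*} [Fintype ι] [DecidableEq ι]

/-- Infinitesimal conjugation does not change the characteristic polynomial: over the dual
numbers, `A + ε [A, V] = (1 - ε V) A (1 + ε V)`. -/
lemma charpoly_add_smul_commutator {R : Type*} [CommRing R] {e : R} (he : e * e = 0)
    (A V : Matrix ι ι R) : (A + e • (A * V - V * A)).charpoly = A.charpoly := by
  have h (W : Matrix ι ι R) : (e • V) * (W * (e • V)) = 0 := by
    rw [Matrix.smul_mul, Matrix.mul_smul, Matrix.mul_smul, smul_smul, he, zero_smul]
  have h1 : (e • V) * (e • V) = 0 := by simpa only [one_mul] using h 1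
  let U : (Matrix ι ι R)ˣ :=
    ⟨1 - e • V, 1 + e • V, by rw [sub_mul, mul_add, mul_add, h1]; simp,
      by rw [add_mul, mul_sub, mul_sub, h1]; simp⟩
  have hU : A + e • (A * V - V * A) = U.val * A * U⁻¹.val := by
    change _ = (1 - e • V) * A * (1 + e • V)
    rw [mul_assoc, sub_mul, one_mul, mul_add A, mul_one, mul_add, h A, smul_sub, Matrix.mul_smul,
      Matrix.smul_mul]
    abel
  rw [hU, Matrix.coe_units_inv, charpoly_units_conj U A]

/-- A Lax equation `A' = [A, V]` for a matrix of formal power series keeps the characteristic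
polynomial constant, so that it is the one of the limit of `A` at `+∞`. -/
lemma charpoly_eq_charpoly_lim {A V : ℝ → Matrix ι ι 𝕜⟦X⟧} {B : Matrix ι ι 𝕜⟦X⟧}
    (hder : ∀ x a b n, HasDerivAt (fun y => coeff n (A y a b))
      (coeff n ((A x * V x - V x * A x) a b)) x)
    (hlim : ∀ a b n, Tendsto (fun y => coeff n (A y a b)) atTop (𝓝 (coeff n (B a b)))) (x : ℝ) :
    (A x).charpoly = B.charpoly := by
  let S := convergentFunctions 𝕜
  let c (a b : ι) (n : ℕ) : S := ⟨(fun y => coeff n (A y a b), coeff n (B a b)),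
    fun y => (hder y a b n).differentiableAt, hlim a b n⟩
  let F : Matrix ι ι S⟦X⟧ := of fun a b => PowerSeries.mk (c a b)
  have h_eval (y : ℝ) : F.map (PowerSeries.map (convergentFunctions.eval y)) = A y := by
    ext a b n; simp [F, c, convergentFunctions.eval]
  have h_lim : F.map (PowerSeries.map convergentFunctions.lim) = B := by
    ext a b n; simp [F, c, convergentFunctions.lim]
  let φ : 𝕜⟦X⟧ →+* (DualNumber 𝕜)⟦X⟧ := PowerSeries.map (TrivSqZeroExt.inlHom 𝕜 𝕜)
  have h_jet (y : ℝ) : (F.map (PowerSeries.map (convergentFunctions.jet y))).charpoly =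
      (A y).charpoly.map φ := by
    have he : (C DualNumber.eps : (DualNumber 𝕜)⟦X⟧) * C DualNumber.eps = 0 := by
      rw [← map_mul, DualNumber.eps_mul_eps, map_zero]
    rw [← charpoly_map, ← charpoly_add_smul_commutator he ((A y).map φ) ((V y).map φ)]
    congr 1
    rw [← Matrix.map_mul, ← Matrix.map_mul, ← Matrix.map_sub φ (map_sub φ)]
    ext a b n : 2
    have h : (coeff n) (F.map (PowerSeries.map (convergentFunctions.jet y)) a b) =
        .inl (coeff n (A y a b)) + .inr (deriv (fun z => coeff n (A z a b)) y) := by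
      rw [Matrix.map_apply, coeff_map, show F a b = PowerSeries.mk (c a b) from rfl, coeff_mk]
      rfl
    rw [h, (hder y a b n).deriv]
    simp only [Matrix.add_apply, Matrix.smul_apply, Matrix.map_apply, smul_eq_mul, map_add,
      coeff_C_mul, φ, coeff_map, TrivSqZeroExt.inlHom_apply]
    refine TrivSqZeroExt.ext ?_ ?_ <;> simp
  rw [← h_eval x, ← h_lim, charpoly_map, charpoly_map]
  ext r n
  rw [Polynomial.coeff_map, Polynomial.coeff_map, coeff_map, coeff_map]
  refine convergentFunctions.eval_eq_lim (fun y => ?_) x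
  have h := congrArg (fun p => (coeff n (Polynomial.coeff p r)).snd) (h_jet y)
  simp only [charpoly_map, Polynomial.coeff_map, coeff_map, φ] at h
  exact h

end Isospectral

/-! ### Uniqueness of decaying solutions -/

section AdjointMatrix

open PowerSeries Matrix LieSeries Finset

variable {𝕜 L ι : Type*} [Field 𝕜] [LieRing L] [LieAlgebra 𝕜 L] [Fintype ι] [DecidableEq ι]
  (b : Module.Basis ι 𝕜 L)

/-- The matrix of `ad X` in the basis `b`, for a formal power series `X` with coefficients in `L`.
-/
noncomputable def adMatrix (X : ℕ → L) : Matrix ι ι 𝕜⟦X⟧ :=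
  of fun r c => PowerSeries.mk fun k => LinearMap.toMatrix b b (LieAlgebra.ad 𝕜 L (X k)) r c

lemma coeff_adMatrix (X : ℕ → L) (r c : ι) (k : ℕ) :
    coeff k (adMatrix b X r c) = LinearMap.toMatrix b b (LieAlgebra.ad 𝕜 L (X k)) r c := by
  simp [adMatrix]

/-- The coordinates of a formal power series in the basis `b`. -/
noncomputable def coordVector (X : ℕ → L) : ι → 𝕜⟦X⟧ :=
  fun r => PowerSeries.mk fun k => b.repr (X k) r

lemma adMatrix_mulVec (X Z : ℕ → L) :
    adMatrix b X *ᵥ coordVector b Z = coordVector b (conv X Z) := by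
  ext r n
  simp only [mulVec, dotProduct, map_sum, coeff_mul, coeff_adMatrix, coordVector, coeff_mk, conv,
    Finsupp.finsetSum_apply]
  rw [sum_comm]
  refine sum_congr rfl fun p _ => ?_
  exact congrFun (LinearMap.toMatrix_mulVec_repr b b (LieAlgebra.ad 𝕜 L (X p.1)) (Z p.2)) r

lemma adMatrix_pow_mulVec (X Z : ℕ → L) (n : ℕ) :
    (adMatrix b X ^ n) *ᵥ coordVector b Z = coordVector b ((conv X)^[n] Z) := by
  induction n with
  | zero => simp
  | succ n ih => rw [pow_succ', ← mulVec_mulVec, ih, adMatrix_mulVec, Function.iterate_succ_apply']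

lemma coeff_adMatrix_mul (X Y : ℕ → L) (r c : ι) (n : ℕ) :
    coeff n ((adMatrix b X * adMatrix b Y) r c) = ∑ p ∈ antidiagonal n,
      LinearMap.toMatrix b b (LieAlgebra.ad 𝕜 L (X p.1) * LieAlgebra.ad 𝕜 L (Y p.2)) r c := by
  simp only [Matrix.mul_apply, map_sum, coeff_mul, coeff_adMatrix, LinearMap.toMatrix_mul]
  rw [sum_comm]

lemma coeff_adMatrix_commutator (X Y : ℕ → L) (r c : ι) (n : ℕ) :
    coeff n ((adMatrix b X * adMatrix b Y - adMatrix b Y * adMatrix b X) r c) =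
      LinearMap.toMatrix b b (LieAlgebra.ad 𝕜 L (conv X Y n)) r c := by
  have h : coeff n ((adMatrix b Y * adMatrix b X) r c) = ∑ p ∈ antidiagonal n,
      LinearMap.toMatrix b b (LieAlgebra.ad 𝕜 L (Y p.2) * LieAlgebra.ad 𝕜 L (X p.1)) r c := by
    rw [coeff_adMatrix_mul]
    exact (Nat.sum_antidiagonal_swap (f := fun p : ℕ × ℕ => LinearMap.toMatrix b b
      (LieAlgebra.ad 𝕜 L (Y p.2) * LieAlgebra.ad 𝕜 L (X p.1)) r c))
  rw [Matrix.sub_apply, map_sub, h, coeff_adMatrix_mul, ← sum_sub_distrib]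
  simp only [conv, map_sum, LieHom.map_lie, Matrix.sum_apply, LieRing.of_associative_ring_bracket,
    map_sub, Matrix.sub_apply]

/-- The Cayley–Hamilton theorem for a series `ad X` whose characteristic polynomial has
coefficients in the base field. -/
lemma sum_coeff_smul_iterate_conv {X : ℕ → L} {χ : Polynomial 𝕜}
    (h : (adMatrix b X).charpoly = χ.map C) (Z : ℕ → L) (n : ℕ) :
    ∑ r ∈ range (χ.natDegree + 1), χ.coeff r • (conv X)^[r] Z n = 0 := by
  have h1 := aeval_self_charpoly (adMatrix b X)
  rw [h, Polynomial.aeval_eq_sum_range, Polynomial.natDegree_map_eq_of_injective C_injective] at h1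
  refine b.repr.injective (Finsupp.ext fun c => ?_)
  have h2 := congrArg (fun A : Matrix ι ι 𝕜⟦X⟧ => coeff n ((A *ᵥ coordVector b Z) c)) h1
  simp only [Polynomial.coeff_map, sum_mulVec, smul_mulVec, adMatrix_pow_mulVec, Finset.sum_apply,
    Pi.smul_apply, smul_eq_mul, map_sum, coeff_C_mul, coordVector, coeff_mk, zero_mulVec,
    Pi.zero_apply, map_zero] at h2
  simpa [Finsupp.finsetSum_apply] using h2

end AdjointMatrix

section Bilinear

variable {𝕜 E F G : Type*} [RCLike 𝕜] [NormedAddCommGroup E] [NormedSpace 𝕜 E]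
  [FiniteDimensional 𝕜 E] [NormedAddCommGroup F] [NormedSpace 𝕜 F] [FiniteDimensional 𝕜 F]
  [NormedAddCommGroup G] [NormedSpace 𝕜 G] [NormedSpace ℝ E] [IsScalarTower ℝ 𝕜 E]
  [NormedSpace ℝ F] [IsScalarTower ℝ 𝕜 F] [NormedSpace ℝ G] [IsScalarTower ℝ 𝕜 G]
  (B : E →ₗ[𝕜] F →ₗ[𝕜] G)

lemma LinearMap.contDiff_real₂ : ContDiff ℝ ∞ fun p : E × F => B p.1 p.2 :=
  B.toContinuousBilinearMap.isBoundedBilinearMap.contDiff.restrict_scalars ℝ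

lemma LinearMap.hasDerivAt₂ {f : ℝ → E} {g : ℝ → F} {f' : E} {g' : F} {x : ℝ}
    (hf : HasDerivAt f f' x) (hg : HasDerivAt g g' x) :
    HasDerivAt (fun y => B (f y) (g y)) (B f' (g x) + B (f x) g') x := by
  have h := (B.toContinuousBilinearMap.isBoundedBilinearMap.hasFDerivAt (f x, g x)).restrictScalars
    ℝ |>.comp_hasDerivAt x (hf.prodMk hg)
  simpa [add_comm] using! h

end Bilinear

section Uniqueness

open LieSeries Finset

variable (𝕜 : Type*) {𝔤 : Type*} [RCLike 𝕜] [NormedLieRing 𝔤] [NormedLieAlgebra 𝕜 𝔤]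
  [NormedSpace ℝ 𝔤] [IsScalarTower ℝ 𝕜 𝔤] [FiniteDimensional 𝕜 𝔤]

/-- The bracket as a bilinear map. -/
def lieBilin : 𝔤 →ₗ[𝕜] 𝔤 →ₗ[𝕜] 𝔤 := (LieAlgebra.ad 𝕜 𝔤 : 𝔤 →ₗ[𝕜] Module.End 𝕜 𝔤)

include 𝕜 in
lemma HasDerivAt.conv {X Z : ℝ → ℕ → 𝔤} {X' Z' : ℕ → 𝔤} {x : ℝ}
    (hX : ∀ k, HasDerivAt (fun y => X y k) (X' k) x)
    (hZ : ∀ k, HasDerivAt (fun y => Z y k) (Z' k) x) (n : ℕ) :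
    HasDerivAt (fun y => LieSeries.conv (X y) (Z y) n)
      (LieSeries.conv X' (Z x) n + LieSeries.conv (X x) Z' n) x := by
  simp only [LieSeries.conv, ← sum_add_distrib]
  exact HasDerivAt.fun_sum fun p _ => (lieBilin 𝕜).hasDerivAt₂ (hX p.1) (hZ p.2)

include 𝕜 in
lemma tendsto_conv_zero {X Z : ℝ → ℕ → 𝔤} {X₀ : ℕ → 𝔤}
    (hX : ∀ k, Tendsto (fun y => X y k) atTop (𝓝 (X₀ k)))
    (hZ : ∀ k, Tendsto (fun y => Z y k) atTop (𝓝 0)) (n : ℕ) :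
    Tendsto (fun y => LieSeries.conv (X y) (Z y) n) atTop (𝓝 0) := by
  have h : (0 : 𝔤) = ∑ p ∈ antidiagonal n, ⁅X₀ p.1, (0 : 𝔤)⁆ := by simp
  rw [h]
  refine tendsto_finsetSum _ fun p _ => ?_
  exact ((lieBilin 𝕜).contDiff_real₂.continuous.tendsto (X₀ p.1, (0 : 𝔤))).comp
    ((hX p.1).prodMk_nhds (hZ p.2))

/-- A solution, on a line with coordinate `x`, of the relation on `N_{i∞}` with vanishing boundary
conditions at `+∞`. -/
structure IsDecayingSolution (i : ℕ) (X : ℝ → ℕ → 𝔤) : Prop where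
  hasDerivAt : ∀ k x, HasDerivAt (fun y => X y k) (conv (head i (X x)) (X x) (k + i)) x
  tendsto : ∀ k, 1 ≤ k → Tendsto (fun y => X y k) atTop (𝓝 0)

namespace IsDecayingSolution

variable {𝕜} {i : ℕ} {X Y : ℝ → ℕ → 𝔤}

lemma apply_zero (hX : IsDecayingSolution i X) (x y : ℝ) : X x 0 = X y 0 := by
  have := NormedLieRing.isAddTorsionFree 𝔤
  refine is_const_of_deriv_eq_zero (fun z => (hX.hasDerivAt 0 z).differentiableAt)
    (fun z => ?_) x y
  rw [(hX.hasDerivAt 0 z).deriv, conv_head_self _ (by omega)]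

/-- The limit of a decaying solution at `+∞`: the leading coefficient is constant, and all the
other ones vanish in the limit. -/
def limit (X : ℝ → ℕ → 𝔤) : ℕ → 𝔤 := fun k => if k = 0 then X 0 0 else 0

lemma tendsto_limit (hX : IsDecayingSolution i X) (k : ℕ) :
    Tendsto (fun y => X y k) atTop (𝓝 (limit X k)) := by
  rcases Nat.eq_zero_or_pos k with rfl | hk
  · exact tendsto_const_nhds.congr fun y => hX.apply_zero 0 y
  · rw [limit, if_neg hk.ne']
    exact hX.tendsto k hk

/-- As `[X, X] = 0`, the head of `X` in the equation can be replaced by the negative of the tail;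
in this form no power of `z⁻¹` occurs. -/
lemma conv_head_eq (U : ℕ → 𝔤) (k : ℕ) : conv (head i U) U (k + i) =
    conv U (fun p => (U - head i U) (p + i)) k := by
  have := NormedLieRing.isAddTorsionFree 𝔤
  rw [← conv_shift_right (Y := U - head i U) (fun p hp => by simp [head, hp.le]), conv_sub,
    Pi.sub_apply, conv_self, zero_sub, conv_skew]

/-- The spectrum of `ad X` is constant along the line, so that it is the one at infinity, where
only the leading coefficient is left. -/
lemma charpoly_adMatrix {ι : Type*} [Fintype ι] [DecidableEq ι] (b : Module.Basis ι 𝕜 𝔤)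
    (hX : IsDecayingSolution i X) (x : ℝ) : (adMatrix b (X x)).charpoly =
      (LinearMap.toMatrix b b (LieAlgebra.ad 𝕜 𝔤 (X 0 0))).charpoly.map PowerSeries.C := by
  let entry (r c : ι) : 𝔤 →L[ℝ] 𝕜 := ((Matrix.entryLinearMap 𝕜 𝕜 r c) ∘ₗ
    (LinearMap.toMatrix b b).toLinearMap ∘ₗ
    (LieAlgebra.ad 𝕜 𝔤 : 𝔤 →ₗ[𝕜] Module.End 𝕜 𝔤)).toContinuousLinearMap.restrictScalars ℝ
  have hlim : adMatrix b (limit X) =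
      (LinearMap.toMatrix b b (LieAlgebra.ad 𝕜 𝔤 (X 0 0))).map PowerSeries.C := by
    ext r c n
    rw [coeff_adMatrix, Matrix.map_apply, PowerSeries.coeff_C, limit]
    split_ifs <;> simp
  rw [← Matrix.charpoly_map, ← hlim]
  refine charpoly_eq_charpoly_lim (A := fun y => adMatrix b (X y))
    (V := fun y => adMatrix b fun p => (X y - head i (X y)) (p + i)) ?_ ?_ x
  · intro y r c n
    rw [coeff_adMatrix_commutator]
    simp only [coeff_adMatrix]
    rw [← conv_head_eq]
    exact (entry r c).hasFDerivAt.comp_hasDerivAt y (hX.hasDerivAt n y)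
  · intro r c n
    simp only [coeff_adMatrix]
    exact ((entry r c).continuous.tendsto _).comp (hX.tendsto_limit n)

include 𝕜 in
/-- Two decaying solutions with the same head are equal. Let `z^N` be the leading power of their
difference `D`. The iterates `(ad X)^r D` have leading term `∂ʳ D_N z^{N + i r}`, while `ad X` is
annihilated by the characteristic polynomial of `ad X₀`, so that the lowest nonzero coefficient of
this polynomial gives `∂ˢ D_N = 0`. As all iterates tend to zero, so does each `∂ʳ D_N`, and hence
`D_N = 0`. -/
theorem eq_of_head_eq (hi : 1 ≤ i) (hX : IsDecayingSolution i X) (hY : IsDecayingSolution i Y)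
    (h : ∀ x, head i (X x) = head i (Y x)) : X = Y := by
  have := NormedLieRing.isAddTorsionFree 𝔤
  let D (r : ℕ) (x : ℝ) : ℕ → 𝔤 := (conv (X x))^[r] (X x - Y x)
  have D_succ (r : ℕ) (x : ℝ) : D (r + 1) x = conv (X x) (D r x) :=
    Function.iterate_succ_apply' _ _ _
  suffices hD : ∀ N x, D 0 x N = 0 from
    funext fun x => funext fun N => sub_eq_zero.mp (hD N x)
  have head_D {k : ℕ} (hk : k ≤ i) (x : ℝ) : D 0 x k = 0 := by
    have := congrFun (h x) k
    rw [head_of_le _ hk, head_of_le _ hk] at this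
    exact sub_eq_zero.mpr this
  intro N
  induction N using Nat.strong_induction_on with | _ N IH => ?_
  rcases le_or_gt N i with hN | hN
  · exact head_D hN
  -- The order, the differential equation and the decay of `(ad X)^r D`. The equation says that
  -- `zⁱ ∂Z = [head i X, Z]`, and it passes from `Z` to `[X, Z]` by the Jacobi identity.
  have key (r : ℕ) : (∀ x, ∀ k < N + i * r, D r x k = 0) ∧
      (∀ k x, HasDerivAt (fun y => D r y k) (conv (head i (X x)) (D r x) (k + i)) x) ∧
      ∀ k, Tendsto (fun y => D r y k) atTop (𝓝 0) := by
    induction r with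
    | zero =>
      refine ⟨fun x k hk => IH k (by simpa using hk) x, fun k x => ?_, fun k => ?_⟩
      · have := (hX.hasDerivAt k x).sub (hY.hasDerivAt k x)
        rw [← h x, ← Pi.sub_apply, ← conv_sub] at this
        exact this
      · rcases Nat.eq_zero_or_pos k with rfl | hk
        · simp only [head_D (Nat.zero_le i)]
          exact tendsto_const_nhds
        · have := (hX.tendsto k hk).sub (hY.tendsto k hk)
          rw [sub_zero] at this
          exact this
    | succ r ih =>
      obtain ⟨hz, hd, ht⟩ := ih
      have hhead (x : ℝ) : ∀ k < i, conv (head i (X x)) (D r x) k = 0 := fun k hk =>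
        conv_eq_zero_of_lt (hz x) (hk.trans (by nlinarith))
      simp only [D_succ]
      refine ⟨fun x k hk => ?_, fun k x => ?_, fun k => tendsto_conv_zero 𝕜 hX.tendsto_limit ht k⟩
      · rw [mul_add, mul_one, ← add_assoc] at hk
        rw [← conv_head_of_le (i := i) (hz x) hk.le]
        -- Below order `N + i (r + 1)` the bracket is `zⁱ ∂ (ad X)^r D`, which vanishes there.
        rcases lt_or_ge k i with hki | hki
        · exact hhead x k hki
        · obtain ⟨k, rfl⟩ := Nat.exists_eq_add_of_le' hki
          have h0 : (fun y => D r y k) = fun _ => 0 := funext fun y => hz y k (by omega)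
          have := hd k x
          rw [h0] at this
          exact this.unique (hasDerivAt_const x 0)
      · have := HasDerivAt.conv 𝕜 (fun k => hX.hasDerivAt k x) (fun k => hd k x) k
        rw [← conv_shift_left (Y := conv (head i (X x)) (X x)) fun k hk => conv_head_self _ hk.le,
          ← conv_shift_right (hhead x), ← Pi.add_apply, ← conv_conv] at this
        exact this
  let χ := (LinearMap.toMatrix (Module.finBasis 𝕜 𝔤) (Module.finBasis 𝕜 𝔤)
    (LieAlgebra.ad 𝕜 𝔤 (X 0 0))).charpoly
  have hχ : χ ≠ 0 := (Matrix.charpoly_monic _).ne_zero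
  -- The leading coefficient of `(ad X)^(r+1) D` is the derivative of that of `(ad X)^r D`.
  have vanish (r : ℕ) (hr : ∀ x, D r x (N + i * r) = 0) : ∀ x, D 0 x N = 0 := by
    induction r with
    | zero => simpa using hr
    | succ r ih =>
      obtain ⟨hz, hd, ht⟩ := key r
      refine ih fun x => ?_
      have hder (y : ℝ) : deriv (fun y => D r y (N + i * r)) y = 0 := by
        rw [(hd _ y).deriv, conv_head_of_le (hz y) le_rfl, ← D_succ, ← hr y, mul_add, mul_one,
          add_assoc]
      have hconst := is_const_of_deriv_eq_zero (fun y => (hd _ y).differentiableAt) hder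
      exact tendsto_nhds_unique (tendsto_const_nhds.congr fun y => hconst x y) (ht (N + i * r))
  refine vanish χ.natTrailingDegree fun x => ?_
  -- In the coefficient of `z^{N + i s}` of the Cayley–Hamilton identity, `s` being the order of
  -- `χ` at zero, only the term `r = s` survives: later terms have higher order as `i ≥ 1`.
  have hsum := sum_coeff_smul_iterate_conv _ (hX.charpoly_adMatrix (Module.finBasis 𝕜 𝔤) x)
    (X x - Y x) (N + i * χ.natTrailingDegree)
  rw [sum_eq_single χ.natTrailingDegree] at hsum
  · exact (smul_eq_zero.mp hsum).resolve_left (Polynomial.trailingCoeff_nonzero_iff_nonzero.mpr hχ)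
  · intro r _ hr
    rcases lt_or_gt_of_ne hr with hlt | hgt
    · rw [Polynomial.coeff_eq_zero_of_lt_natTrailingDegree hlt, zero_smul]
    · have : N + i * χ.natTrailingDegree < N + i * r := by nlinarith
      rw [show (conv (X x))^[r] (X x - Y x) (N + i * χ.natTrailingDegree) = 0 from
        (key r).1 x _ this, smul_zero]
  · intro hmem
    exact absurd (mem_range.mpr (Nat.lt_succ_of_le χ.natTrailingDegree_le_natDegree)) hmem

end IsDecayingSolution

end Uniqueness

/-! ### Lines and planes in the multi-time space -/

section Slices

variable {𝔤 : Type*} [NormedAddCommGroup 𝔤] [NormedSpace ℝ 𝔤]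

lemma slicePoint_zero (a : MultiTime) (i j : ℕ+) (x : ℝ) :
    slicePoint a i j x 0 = a + Finsupp.single i x := by
  simp [slicePoint]

lemma slicePoint_eq_add_left (a : MultiTime) (i j : ℕ+) (x t : ℝ) :
    slicePoint a i j x t = a + Finsupp.single j t + Finsupp.single i x := by
  simp only [slicePoint]; abel

/-- Smooth fields are smooth on planes: a plane `a + N_{ij}` lies in the coordinate subspace of
the coordinates `i`, `j` and those in the support of `a`. -/
lemma IsSmoothField.contDiff_slicePoint {f : MultiTime → 𝔤} (hf : IsSmoothField f) (a : MultiTime)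
    (i j : ℕ+) : ContDiff ℝ ∞ fun p : ℝ × ℝ => f (slicePoint a i j p.1 p.2) := by
  let s : Finset ℕ+ := insert i (insert j a.support)
  have hsum (b : MultiTime) (hb : b.support ⊆ s) :
      ∑ k : s, Finsupp.single (k : ℕ+) (b k) = b := by
    conv_rhs => rw [← Finsupp.sum_single b, Finsupp.sum_of_support_subset b hb _ (by simp)]
    exact Finset.sum_coe_sort s fun k => Finsupp.single k (b k)
  have hsupp (x t : ℝ) : (slicePoint a i j x t).support ⊆ s := by
    intro k hk
    by_contra h
    simp only [s, Finset.mem_insert, not_or, Finsupp.mem_support_iff, not_not] at h hk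
    apply hk
    simp [slicePoint, Ne.symm h.1, Ne.symm h.2.1, h.2.2]
  have hv : ContDiff ℝ ∞ fun (p : ℝ × ℝ) (k : s) => slicePoint a i j p.1 p.2 k := by
    rw [contDiff_pi]
    intro k
    have hs (l : ℕ+) (y : ℝ) : Finsupp.single l y (k : ℕ+) = y * Finsupp.single l 1 (k : ℕ+) := by
      by_cases h : l = k <;> simp [h]
    have h : (fun p : ℝ × ℝ => slicePoint a i j p.1 p.2 k) = fun p => a k +
        p.1 * Finsupp.single i 1 (k : ℕ+) + p.2 * Finsupp.single j 1 (k : ℕ+) := by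
      funext p
      rw [slicePoint, Finsupp.add_apply, Finsupp.add_apply, hs i p.1, hs j p.2]
    rw [h]
    fun_prop
  have := (hf s).comp hv
  simpa only [Function.comp_def, hsum _ (hsupp _ _)] using! this

lemma partialDeriv_slicePoint_snd (f : MultiTime → 𝔤) (a : MultiTime) (i j : ℕ+) (x t : ℝ) :
    partialDeriv j f (slicePoint a i j x t) = deriv (fun τ => f (slicePoint a i j x τ)) t := by
  have h : (fun s => f (slicePoint a i j x t + Finsupp.single j s)) =
      fun s => (fun τ => f (slicePoint a i j x τ)) (t + s) := by
    funext s; simp only [slicePoint, add_assoc, Finsupp.single_add]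
  rw [partialDeriv, h, deriv_comp_const_add (fun τ => f (slicePoint a i j x τ)), add_zero]

lemma partialDeriv_slicePoint_fst (f : MultiTime → 𝔤) (a : MultiTime) (i j : ℕ+) (x t : ℝ) :
    partialDeriv i f (slicePoint a i j x t) = deriv (fun y => f (slicePoint a i j y t)) x := by
  have h (y : ℝ) : slicePoint a i j y t = slicePoint a j i t y := by
    simp only [slicePoint]; abel
  simp only [h]
  exact partialDeriv_slicePoint_snd f a j i t x

lemma IsSmoothField.hasDerivAt_line {f : MultiTime → 𝔤} (hf : IsSmoothField f) (a : MultiTime)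
    (i : ℕ+) (x : ℝ) : HasDerivAt (fun y => f (a + Finsupp.single i y))
      (partialDeriv i f (a + Finsupp.single i x)) x := by
  have hs := (hf.contDiff_slicePoint a i i).comp
    (contDiff_id.prodMk (contDiff_const (c := (0 : ℝ))))
  have h := (hs.differentiable (by simp) x).hasDerivAt
  rw [← slicePoint_zero a i i x, partialDeriv_slicePoint_fst]
  simpa only [Function.comp_def, slicePoint_zero, id] using! h

end Slices

section ExpressesThrough

open LieSeries Loop

variable (𝕜 : Type*) {𝔤 : Type*} [RCLike 𝕜] [NormedLieRing 𝔤] [NormedLieAlgebra 𝕜 𝔤]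
  [NormedSpace ℝ 𝔤] [IsScalarTower ℝ 𝕜 𝔤] [FiniteDimensional 𝕜 𝔤]

lemma head_eq_of_truncation_eq {L : Type*} [LieRing L] {i : ℕ+} {X Y : ℕ → L}
    (h : truncation i X = truncation i Y) :
    head i X = head i Y := by
  funext k
  rw [← truncation_sub, ← truncation_sub, h]

lemma isDecayingSolution_line {M : ℕ → MultiTime → 𝔤} {i : ℕ+} (hM : ∀ k, IsSmoothField (M k))
    (hv : VanishesAlong M i) (hz : ZeroCurvatureInfty M i) (a : MultiTime) :
    IsDecayingSolution i fun x k => M k (a + Finsupp.single i x) where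
  hasDerivAt k x := by
    have h := (hM k).hasDerivAt_line a i x
    rwa [(zeroCurvatureInfty_iff M i).mp hz] at h
  tendsto k hk := (hv k hk a).mono_left atTop_le_cocompact

include 𝕜 in
/-- On a line in the direction `aᵢ`, the fields `Mₖ` are functions of `M^{(i)}`, since the
solution with given head is unique. -/
theorem exists_expressesThrough (i : ℕ+) : ∃ F : (ℝ → Loop 𝔤) → ℕ → ℝ → 𝔤,
    ∀ M : ℕ → MultiTime → 𝔤, (∀ k, IsSmoothField (M k)) → VanishesAlong M i →
      ZeroCurvatureInfty M i → ExpressesThrough F M i := by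
  classical
  let P (ℓ : ℝ → Loop 𝔤) (X : ℝ → ℕ → 𝔤) : Prop :=
    IsDecayingSolution i X ∧ ∀ x, truncation i (X x) = ℓ x
  refine ⟨fun ℓ k x => if h : ∃ X, P ℓ X then h.choose x k else 0, fun M hM hv hz a => ?_⟩
  have hX := isDecayingSolution_line hM hv hz a
  have hex : ∃ X, P (fun x => conn M i (a + Finsupp.single i x)) X := ⟨_, hX, fun _ => rfl⟩
  have heq := IsDecayingSolution.eq_of_head_eq (𝕜 := 𝕜) i.2 hex.choose_spec.1 hX fun x =>
    head_eq_of_truncation_eq (hex.choose_spec.2 x)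
  funext k x
  exact (dif_pos hex).trans (by rw [heq])

end ExpressesThrough

/-! ### Pairings of loops -/

namespace Loop

open Finset

variable {𝕜 L : Type*} [Field 𝕜] [LieRing L] [LieAlgebra 𝕜 L]

lemma pairing_mode (X : Loop L) (k : ℤ) (v : L) :
    pairing 𝕜 X (mode k v) = killingForm 𝕜 L (X (-1 - k)) v := by
  rw [pairing, finsum_eq_single _ (-1 - k)]
  · simp [mode]
  · intro p hp
    simp [mode, show ¬ -1 - p = k by omega]

lemma mode_pairing (X : Loop L) (k : ℤ) (v : L) :
    pairing 𝕜 (mode k v) X = killingForm 𝕜 L v (X (-1 - k)) := by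
  rw [pairing, finsum_eq_single _ k]
  · simp [mode]
  · intro p hp
    simp [mode, hp]

/-- The nonnegative powers of `λ` form an isotropic subspace, so that only the monomial
contributes. -/
lemma add_smul_mode_pairing {X Y : Loop L} (hX : ∀ n < 0, X n = 0) (hY : ∀ n < 0, Y n = 0)
    (c : 𝕜) (k : ℤ) (v : L) :
    pairing 𝕜 (X + c • mode k v) Y = c * killingForm 𝕜 L v (Y (-1 - k)) := by
  have h (p : ℤ) : killingForm 𝕜 L (X p) (Y (-1 - p)) = 0 := by
    rcases lt_or_ge p 0 with hp | hp
    · simp [hX p hp]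
    · simp [hY (-1 - p) (by omega)]
  rw [← smul_eq_mul, ← mode_pairing, pairing, pairing, smul_finsum]
  refine finsum_congr fun p => ?_
  simp [h]

lemma mode_bracket (Y : Loop L) (k n : ℤ) (v : L) : bracket (mode k v) Y n = ⁅v, Y (n - k)⁆ := by
  rw [bracket, finsum_eq_single _ k]
  · simp [mode]
  · intro p hp
    simp [mode, hp]

lemma bracket_eq_sum {X Y : Loop L} {N : ℤ} (hX : ∀ p, p < 0 ∨ N < p → X p = 0) (n : ℤ) :
    bracket X Y n = ∑ p ∈ Icc 0 N, ⁅X p, Y (n - p)⁆ := by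
  refine finsum_eq_sum_of_support_subset _ fun p hp => ?_
  rw [coe_Icc, Set.mem_Icc]
  by_contra h
  exact hp (by simp [hX p (by omega)])

/-- Invariance of the residue pairing. -/
lemma pairing_mode_bracket {X Y : Loop L} {N : ℤ} (hX : ∀ p, p < 0 ∨ N < p → X p = 0)
    (k : ℤ) (v : L) : pairing 𝕜 X (bracket (mode k v) Y) =
      killingForm 𝕜 L (bracket Y X (-1 - k)) v := by
  rw [← bracket_skew, bracket_eq_sum hX, map_neg, map_sum, LinearMap.neg_apply,
    LinearMap.sum_apply, ← sum_neg_distrib, pairing,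
    finsum_eq_sum_of_support_subset (s := Icc 0 N)]
  · refine sum_congr rfl fun p _ => ?_
    rw [mode_bracket, ← lie_skew, map_neg, killingForm, LieModule.traceForm_apply_lie_apply,
      show -1 - p - k = -1 - k - p by ring]
  · intro p hp
    rw [coe_Icc, Set.mem_Icc]
    by_contra h
    exact hp (by simp [hX p (by omega)])

lemma conn_support {𝔤 : Type*} [NormedLieRing 𝔤] (M : ℕ → MultiTime → 𝔤) (i : ℕ+) (a : MultiTime)
    (n : ℤ) (hn : n < 0 ∨ ((i : ℕ) : ℤ) < n) : conn M i a n = 0 :=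
  hn.elim (truncation_of_neg _ i) (truncation_of_lt _ i)

lemma posPart_add_smul_mode {X : Loop L} (hX : ∀ n < 0, X n = 0) (c : 𝕜) {k : ℤ} (hk : k < 0)
    (v : L) : posPart (X + c • mode k v) = X := by
  funext n
  rcases lt_or_ge n 0 with h | h
  · rw [posPart, if_neg (by omega), hX n h]
  · simp [posPart, if_pos h, mode, show n ≠ k by omega]

end Loop

/-! ### Test functions -/

section TestFunctions

variable {𝕜 𝔤 : Type*} [RCLike 𝕜] [NormedLieRing 𝔤] [NormedLieAlgebra 𝕜 𝔤]
  [NormedSpace ℝ 𝔤] [IsScalarTower ℝ 𝕜 𝔤] [FiniteDimensional 𝕜 𝔤]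

lemma continuous_killingForm {E : Type*} [TopologicalSpace E] {f v : E → 𝔤}
    (hf : Continuous f) (hv : Continuous v) :
    Continuous fun x => killingForm 𝕜 𝔤 (f x) (v x) :=
  (killingForm 𝕜 𝔤).contDiff_real₂.continuous.comp (hf.prodMk hv)

variable {E : Type*} [NormedAddCommGroup E] [NormedSpace ℝ E]

lemma integrable_killingForm [MeasurableSpace E] [BorelSpace E] {μ : Measure E}
    [IsFiniteMeasureOnCompacts μ] {f v : E → 𝔤} (hf : Continuous f) (hv : IsTestFunction v) :
    Integrable (fun x => killingForm 𝕜 𝔤 (f x) (v x)) μ := by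
  refine (continuous_killingForm hf hv.1.continuous).integrable_of_hasCompactSupport ?_
  exact hv.2.mono fun x hx => by
    contrapose! hx
    simp [Function.notMem_support.mp hx]

/-- The fundamental lemma of the calculus of variations. -/
lemma eq_of_integral_killingForm_eq [LieAlgebra.IsSemisimple 𝕜 𝔤] [FiniteDimensional ℝ E]
    [MeasurableSpace E] [BorelSpace E] {μ : Measure E} [IsLocallyFiniteMeasure μ]
    [μ.IsOpenPosMeasure] {f g : E → 𝔤} (hf : Continuous f) (hg : Continuous g)
    (h : ∀ v : E → 𝔤, IsTestFunction v →
      ∫ x, killingForm 𝕜 𝔤 (f x) (v x) ∂μ = ∫ x, killingForm 𝕜 𝔤 (g x) (v x) ∂μ) : f = g := by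
  have hw (w : 𝔤) :
      (fun x => killingForm 𝕜 𝔤 (f x) w) = fun x => killingForm 𝕜 𝔤 (g x) w := by
    have hfw := continuous_killingForm (𝕜 := 𝕜) hf (continuous_const (y := w))
    have hgw := continuous_killingForm (𝕜 := 𝕜) hg (continuous_const (y := w))
    refine (Continuous.ae_eq_iff_eq μ hfw hgw).mp
      (ae_eq_of_integral_contDiff_smul_eq hfw.locallyIntegrable hgw.locallyIntegrable
        fun φ hφ hφc => ?_)
    have hv : IsTestFunction fun x => φ x • w := ⟨hφ.smul contDiff_const, hφc.smul_right⟩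
    have := h _ hv
    simp only [← algebraMap_smul 𝕜 (φ _) w, map_smul] at this
    simpa only [algebraMap_smul] using this
  funext x
  refine sub_eq_zero.mp ((LieAlgebra.IsKilling.killingForm_nondegenerate 𝕜 𝔤).1 _ fun w => ?_)
  rw [map_sub, LinearMap.sub_apply, congrFun (hw w) x, sub_self]

lemma hasDerivAt_fst {f : ℝ × ℝ → 𝔤} (hf : ContDiff ℝ ∞ f) (t x : ℝ) :
    HasDerivAt (fun τ => f (τ, x)) (fderiv ℝ f (t, x) (1, 0)) t := by
  have h := (hf.differentiable (by simp) (t, x)).hasFDerivAt.comp_hasDerivAt t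
    ((hasDerivAt_id t).prodMk (hasDerivAt_const t x))
  exact h

lemma hasDerivAt_snd {f : ℝ × ℝ → 𝔤} (hf : ContDiff ℝ ∞ f) (t x : ℝ) :
    HasDerivAt (fun y => f (t, y)) (fderiv ℝ f (t, x) (0, 1)) x := by
  have h := (hf.differentiable (by simp) (t, x)).hasFDerivAt.comp_hasDerivAt x
    ((hasDerivAt_const x t).prodMk (hasDerivAt_id x))
  exact h

lemma continuous_fderiv_apply {f : ℝ × ℝ → 𝔤} (hf : ContDiff ℝ ∞ f) (w : ℝ × ℝ) :
    Continuous fun p => fderiv ℝ f p w :=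
  (hf.continuous_fderiv (by simp)).clm_apply continuous_const

/-- Differentiation under the integral sign, against a test function. -/
lemma hasDerivAt_integral_killingForm {f : ℝ × ℝ → 𝔤} (hf : ContDiff ℝ ∞ f) {v : ℝ → 𝔤}
    (hv : IsTestFunction v) (t : ℝ) :
    HasDerivAt (fun τ => ∫ x, killingForm 𝕜 𝔤 (f (τ, x)) (v x))
      (∫ x, killingForm 𝕜 𝔤 (fderiv ℝ f (t, x) (1, 0)) (v x)) t := by
  have hcont : Continuous fun p : ℝ × ℝ => killingForm 𝕜 𝔤 (fderiv ℝ f p (1, 0)) (v p.2) :=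
    continuous_killingForm (continuous_fderiv_apply hf _) (hv.1.continuous.comp continuous_snd)
  obtain ⟨C, hC⟩ := ((isCompact_closedBall t 1).prod hv.2.isCompact).exists_bound_of_continuousOn
    hcont.continuousOn
  refine (hasDerivAt_integral_of_dominated_loc_of_deriv_le (s := Metric.closedBall t 1)
    (F := fun τ x => killingForm 𝕜 𝔤 (f (τ, x)) (v x))
    (F' := fun τ x => killingForm 𝕜 𝔤 (fderiv ℝ f (τ, x) (1, 0)) (v x))
    (bound := (tsupport v).indicator fun _ => C)
    (Metric.closedBall_mem_nhds t one_pos) ?_ ?_ ?_ ?_ ?_ ?_).2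
  · exact .of_forall fun τ => (integrable_killingForm
      (hf.continuous.comp (continuous_const.prodMk continuous_id)) hv).aestronglyMeasurable
  · exact integrable_killingForm (hf.continuous.comp (continuous_const.prodMk continuous_id)) hv
  · exact (integrable_killingForm ((continuous_fderiv_apply hf _).comp
      (continuous_const.prodMk continuous_id)) hv).aestronglyMeasurable
  · refine .of_forall fun x τ hτ => ?_
    by_cases hx : x ∈ tsupport v
    · rw [Set.indicator_of_mem hx]
      exact hC (τ, x) ⟨hτ, hx⟩
    · rw [Set.indicator_of_notMem hx, image_eq_zero_of_notMem_tsupport hx, map_zero, norm_zero]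
  · exact (integrable_indicator_iff (isClosed_tsupport v).measurableSet).mpr
      (integrableOn_const hv.2.isCompact.measure_lt_top.ne)
  · refine .of_forall fun x τ _ => ?_
    simpa using (killingForm 𝕜 𝔤).hasDerivAt₂ (hasDerivAt_fst hf τ x) (hasDerivAt_const τ (v x))

end TestFunctions

/-! ### Coadjoint motion -/

section Coadjoint

open Loop

variable {𝕜 𝔤 : Type*} [RCLike 𝕜] [NormedLieRing 𝔤] [NormedLieAlgebra 𝕜 𝔤]
  [NormedSpace ℝ 𝔤] [IsScalarTower ℝ 𝕜 𝔤] [FiniteDimensional 𝕜 𝔤] [LieAlgebra.IsSemisimple 𝕜 𝔤]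

/-- By invariance of the Killing form and its nondegeneracy, which is Cartan's criterion,
coadjoint motion with smooth momentum and velocity is the equation
`∂ₜμ = [ξ, μ] + ∂ₓξ`. -/
lemma coadjointMotion_iff {μ ξ : ℝ → ℝ → Loop 𝔤} {N : ℤ}
    (hμ : ∀ n, ContDiff ℝ ∞ fun p : ℝ × ℝ => μ p.1 p.2 n)
    (hξ : ∀ n, ContDiff ℝ ∞ fun p : ℝ × ℝ => ξ p.1 p.2 n)
    (hN : ∀ t x p, p < 0 ∨ N < p → μ t x p = 0) :
    CoadjointMotion 𝕜 μ ξ ↔ ∀ t x n, deriv (fun τ => μ τ x n) t =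
      bracket (ξ t x) (μ t x) n + deriv (fun y => ξ t y n) x := by
  have hbr (t : ℝ) (n : ℤ) : Continuous fun x => bracket (ξ t x) (μ t x) n := by
    have h : (fun x => bracket (ξ t x) (μ t x) n) =
        fun x => -∑ p ∈ Finset.Icc 0 N, lieBilin 𝕜 (μ t x p) (ξ t x (n - p)) := by
      funext x
      rw [← bracket_skew, bracket_eq_sum (hN t x)]
      rfl
    rw [h]
    refine (continuous_finsetSum _ fun p _ => ?_).neg
    exact (lieBilin 𝕜).contDiff_real₂.continuous.comp
      (((hμ p).continuous.comp (continuous_const.prodMk continuous_id)).prodMk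
        ((hξ (n - p)).continuous.comp (continuous_const.prodMk continuous_id)))
  have hdμ (t : ℝ) (n : ℤ) : Continuous fun x => deriv (fun τ => μ τ x n) t := by
    simp only [(hasDerivAt_fst (hμ n) t _).deriv]
    exact (continuous_fderiv_apply (hμ n) _).comp (continuous_const.prodMk continuous_id)
  have hdξ (t : ℝ) (n : ℤ) : Continuous fun x => deriv (fun y => ξ t y n) x := by
    simp only [(hasDerivAt_snd (hξ n) t _).deriv]
    exact (continuous_fderiv_apply (hξ n) _).comp (continuous_const.prodMk continuous_id)
  have hleft (k : ℤ) (v : ℝ → 𝔤) (hv : IsTestFunction v) (t : ℝ) : HasDerivAt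
      (fun τ => extPairing 𝕜 (μ τ, 1) (fun x => mode k (v x), 0))
      (∫ x, killingForm 𝕜 𝔤 (deriv (fun τ => μ τ x (-1 - k)) t) (v x)) t := by
    simp only [extPairing, pairing_mode, mul_zero, add_zero]
    simp only [(hasDerivAt_fst (hμ _) t _).deriv]
    exact hasDerivAt_integral_killingForm (hμ (-1 - k)) hv t
  have hright (k : ℤ) (v : ℝ → 𝔤) (hv : IsTestFunction v) (t : ℝ) :
      extPairing 𝕜 (μ t, 1) (extBracket 𝕜 (fun x => mode k (v x), 0) (ξ t, 0)) =
        ∫ x, killingForm 𝕜 𝔤 (bracket (ξ t x) (μ t x) (-1 - k)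
          + deriv (fun y => ξ t y (-1 - k)) x) (v x) := by
    simp only [extPairing, extBracket, cocycle, mode_pairing, pairing_mode_bracket (hN t _),
      one_mul, map_add, LinearMap.add_apply]
    rw [integral_add (integrable_killingForm (hbr t _) hv) (integrable_killingForm (hdξ t _) hv)]
    simp only [LieModule.traceForm_comm 𝕜 𝔤 𝔤 (v _)]
  constructor
  · intro h t x n
    refine congrFun (eq_of_integral_killingForm_eq (𝕜 := 𝕜) (μ := volume) (hdμ t n)
      ((hbr t n).add (hdξ t n)) fun v hv => ?_) x
    have := (hleft (-1 - n) v hv t).unique (h (-1 - n) v hv t)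
    rw [hright _ v hv, sub_sub_cancel] at this
    exact this
  · intro h k v hv t
    rw [hright k v hv]
    simp only [← h]
    exact hleft k v hv t

end Coadjoint

/-! ### The Hamiltonians and Lagrangians of the hierarchy -/

section Connection

open Loop LieSeries

variable {𝔤 : Type*} [NormedLieRing 𝔤]

lemma conn_isBoundedAbove (M : ℕ → MultiTime → 𝔤) (i : ℕ+) (a : MultiTime) :
    (conn M i a).IsBoundedAbove :=
  ⟨(i : ℕ), fun _ hn => truncation_of_lt _ i hn⟩

variable [NormedSpace ℝ 𝔤]

lemma contDiff_conn_slicePoint {M : ℕ → MultiTime → 𝔤} (hM : ∀ k, IsSmoothField (M k))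
    (a : MultiTime) (i j l : ℕ+) (n : ℤ) :
    ContDiff ℝ ∞ fun p : ℝ × ℝ => conn M l (slicePoint a i j p.2 p.1) n := by
  by_cases hn : n < 0 ∨ ((l : ℕ) : ℤ) < n
  · simp only [conn_support M l _ n hn]
    exact contDiff_const
  · obtain ⟨k, hk⟩ : ∃ k : ℕ, n = ((l : ℕ) : ℤ) - k := ⟨((l : ℕ) - n : ℤ).toNat, by omega⟩
    have h (b : MultiTime) : conn M l b n = M k b := by
      rw [hk]
      exact (truncation_sub _ l k).trans (head_of_le _ (by omega))
    simp only [h]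
    exact ContDiff.comp (g := fun p : ℝ × ℝ => M k (slicePoint a i j p.1 p.2))
      (f := fun p : ℝ × ℝ => (p.2, p.1)) ((hM k).contDiff_slicePoint a i j)
      (contDiff_snd.prodMk contDiff_fst)

lemma zeroCurvatureOnSlice_iff (M : ℕ → MultiTime → 𝔤) (i j : ℕ+) (a : MultiTime) :
    ZeroCurvatureOnSlice M i j a ↔ ∀ t x n,
      deriv (fun τ => conn M i (slicePoint a i j x τ) n) t =
        bracket (conn M j (slicePoint a i j x t)) (conn M i (slicePoint a i j x t)) n
          + deriv (fun y => conn M j (slicePoint a i j y t) n) x := by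
  rw [ZeroCurvatureOnSlice, forall_comm]
  refine forall₂_congr fun t x => funext_iff.trans (forall_congr' fun n => ?_)
  rw [curvature, partialDeriv_slicePoint_snd (fun b => conn M i b n),
    partialDeriv_slicePoint_fst (fun b => conn M j b n), ← bracket_skew (conn M i _),
    Pi.zero_apply, ← sub_eq_add_neg, sub_sub, sub_eq_zero, add_comm]

end Connection

section Density

open Loop

variable {𝕜 𝔤 : Type*} [RCLike 𝕜] [NormedLieRing 𝔤] [NormedLieAlgebra 𝕜 𝔤]

/-- The densities of `h_j` and `lᵢ` are linear in the variation: a variation along a negative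
power of `λ` leaves the fields `Mₖ` unchanged, while for a nonnegative power both factors of the
pairing are polynomials in `λ`, whatever the value of `F`. -/
lemma pairing_variation {M : ℕ → MultiTime → 𝔤} {i : ℕ+} {F : (ℝ → Loop 𝔤) → ℕ → ℝ → 𝔤}
    (hF : ExpressesThrough F M i) (j : ℕ+) (b : MultiTime) (c : 𝕜) (k : ℤ) (v : ℝ → 𝔤) (s : ℝ) :
    pairing 𝕜 (conn M i (b + Finsupp.single i s) + c • mode k (v s))
      (truncation j fun l =>
        F (fun y => posPart (conn M i (b + Finsupp.single i y) + c • mode k (v y))) l s) =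
      c * killingForm 𝕜 𝔤 (v s) (conn M j (b + Finsupp.single i s) (-1 - k)) := by
  have hi (x : MultiTime) (n : ℤ) (hn : n < 0) : conn M i x n = 0 := truncation_of_neg _ i hn
  rw [add_smul_mode_pairing (hi _) fun n hn => truncation_of_neg _ j hn]
  congr 2
  rcases lt_or_ge k 0 with hk | hk
  · simp only [posPart_add_smul_mode (hi _) c hk, hF b]
    rfl
  · rw [conn, truncation_of_neg _ j (by omega), truncation_of_neg _ j (by omega)]

lemma integral_killingForm_comm {E : Type*} [MeasurableSpace E] {μ : Measure E} (f v : E → 𝔤) :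
    ∫ x, killingForm 𝕜 𝔤 (v x) (f x) ∂μ = ∫ x, killingForm 𝕜 𝔤 (f x) (v x) ∂μ := by
  simp only [LieModule.traceForm_comm 𝕜 𝔤 𝔤 (v _)]

lemma hasDerivAt_ofReal_mul_iff {𝕜 : Type*} [RCLike 𝕜] {c c' : 𝕜} :
    HasDerivAt (fun ε : ℝ => (ε : 𝕜) * c) c' 0 ↔ c' = c := by
  have h : HasDerivAt (fun ε : ℝ => (ε : 𝕜) * c) c 0 := by
    simpa using (RCLike.ofRealCLM (K := 𝕜)).hasDerivAt.mul_const (x := (0 : ℝ)) c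
  exact ⟨fun h' => h'.unique h, fun h' => h' ▸ h⟩

end Density

section Variation

open Loop

variable {𝕜 𝔤 : Type*} [RCLike 𝕜] [NormedLieRing 𝔤] [NormedLieAlgebra 𝕜 𝔤] [NormedSpace ℝ 𝔤]
  [IsScalarTower ℝ 𝕜 𝔤] [FiniteDimensional 𝕜 𝔤] [LieAlgebra.IsSemisimple 𝕜 𝔤]

/-- Along `L = M^{(i)}` the functional derivative of `h_j` is `M^{(j)}`. -/
theorem isVelocity_hamiltonian_iff {M : ℕ → MultiTime → 𝔤} (hM : ∀ k, IsSmoothField (M k))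
    {i j : ℕ+} {F : (ℝ → Loop 𝔤) → ℕ → ℝ → 𝔤} (hF : ExpressesThrough F M i) (a : MultiTime)
    (G : ℝ → ℝ → Loop 𝔤) :
    IsVelocity 𝕜 (hamiltonian 𝕜 F j) (fun t x => conn M i (slicePoint a i j x t)) G ↔
      G = fun t x => conn M j (slicePoint a i j x t) := by
  have hvar (t : ℝ) (k : ℤ) (v : ℝ → 𝔤) (ε : ℝ) :
      hamiltonian 𝕜 F j (fun x => conn M i (slicePoint a i j x t) + (ε : 𝕜) • mode k (v x)) =
        (ε : 𝕜) *
          ∫ x, killingForm 𝕜 𝔤 (conn M j (slicePoint a i j x t) (-1 - k)) (v x) := by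
    simp only [hamiltonian, slicePoint_eq_add_left, pairing_variation hF]
    rw [integral_const_mul, integral_killingForm_comm]
  have hsmooth (t : ℝ) (n : ℤ) : ContDiff ℝ ∞ fun x => conn M j (slicePoint a i j x t) n :=
    ContDiff.comp (g := fun p : ℝ × ℝ => conn M j (slicePoint a i j p.2 p.1) n)
      (f := fun x : ℝ => (t, x)) (contDiff_conn_slicePoint hM a i j j n)
      (contDiff_const.prodMk contDiff_id)
  simp only [IsVelocity, IsFunctionalDeriv, hvar, hasDerivAt_ofReal_mul_iff, pairing_mode]
  constructor
  · rintro ⟨-, hG, h⟩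
    funext t x n
    refine congrFun (eq_of_integral_killingForm_eq (𝕜 := 𝕜) (μ := volume) (hG t n).continuous
      (hsmooth t n).continuous fun v hv => ?_) x
    simpa only [sub_sub_cancel] using h t (-1 - n) v hv
  · rintro rfl
    exact ⟨fun t x => conn_isBoundedAbove M j _, hsmooth, fun _ _ _ _ => rfl⟩

/-- Along `M^{(j)}` the functional derivative of `lᵢ` is `M^{(i)}`. -/
theorem isMomentum_lagrangian_iff {M : ℕ → MultiTime → 𝔤} (hM : ∀ k, IsSmoothField (M k))
    {i j : ℕ+} {F : (ℝ → Loop 𝔤) → ℕ → ℝ → 𝔤} (hF : ExpressesThrough F M j) (a : MultiTime)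
    (G : ℝ → ℝ → Loop 𝔤) :
    IsMomentum 𝕜 (lagrangian 𝕜 F i) (fun t x => conn M j (slicePoint a i j x t)) G ↔
      G = fun t x => conn M i (slicePoint a i j x t) := by
  have hvar (k : ℤ) (v : ℝ × ℝ → 𝔤) (ε : ℝ) : ∫ t, lagrangian 𝕜 F i
        (fun τ x => conn M j (slicePoint a i j x τ) + (ε : 𝕜) • mode k (v (τ, x))) t =
      (ε : 𝕜) *
        ∫ t, ∫ x, killingForm 𝕜 𝔤 (conn M i (slicePoint a i j x t) (-1 - k)) (v (t, x)) := by
    have h (x t : ℝ) :=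
      pairing_variation hF i (a + Finsupp.single i x) (ε : 𝕜) k (fun τ => v (τ, x)) t
    simp only [lagrangian, slicePoint, h, integral_const_mul, integral_killingForm_comm]
  have hsmooth (n : ℤ) := contDiff_conn_slicePoint hM a i j i n
  have hiter {f : ℝ × ℝ → 𝔤} (hf : Continuous f) {v : ℝ × ℝ → 𝔤} (hv : IsTestFunction v) :
      ∫ t, ∫ x, killingForm 𝕜 𝔤 (f (t, x)) (v (t, x)) = ∫ p, killingForm 𝕜 𝔤 (f p) (v p) := by
    rw [Measure.volume_eq_prod, integral_prod (fun p => killingForm 𝕜 𝔤 (f p) (v p))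
      (integrable_killingForm hf hv)]
  simp only [IsMomentum, IsLagrangianDeriv, hvar, hasDerivAt_ofReal_mul_iff, pairing_mode]
  constructor
  · rintro ⟨-, hG, h⟩
    funext t x n
    refine congrFun (eq_of_integral_killingForm_eq (𝕜 := 𝕜) (μ := volume) (hG n).continuous
      (hsmooth n).continuous fun v hv => ?_) (t, x)
    rw [← hiter (hG n).continuous hv, ← hiter (hsmooth n).continuous hv]
    simpa only [sub_sub_cancel] using h (-1 - n) v hv
  · rintro rfl
    exact ⟨fun t x => conn_isBoundedAbove M i _, hsmooth, fun _ _ _ => rfl⟩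

/-- On both sides the momentum is `M^{(i)}` and the velocity is `M^{(j)}`. -/
lemma coadjointMotion_conn_iff {M : ℕ → MultiTime → 𝔤} (hM : ∀ k, IsSmoothField (M k))
    (i j : ℕ+) (a : MultiTime) :
    CoadjointMotion 𝕜 (fun t x => conn M i (slicePoint a i j x t))
      (fun t x => conn M j (slicePoint a i j x t)) ↔ ZeroCurvatureOnSlice M i j a :=
  (coadjointMotion_iff (contDiff_conn_slicePoint hM a i j i) (contDiff_conn_slicePoint hM a i j j)
    fun _ _ => conn_support M i _).trans (zeroCurvatureOnSlice_iff M i j a).symm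

theorem lie_poisson_tfae {M : ℕ → MultiTime → 𝔤} (hM : ∀ k, IsSmoothField (M k))
    {i j : ℕ+} {F : (ℝ → Loop 𝔤) → ℕ → ℝ → 𝔤} (hF : ExpressesThrough F M i) (a : MultiTime) :
    [LiePoisson 𝕜 (hamiltonian 𝕜 F j) (fun t x => conn M i (slicePoint a i j x t)),
      LiePoissonPDE 𝕜 (hamiltonian 𝕜 F j) (fun t x => conn M i (slicePoint a i j x t)),
      ZeroCurvatureOnSlice M i j a].TFAE := by
  have h1 : LiePoisson 𝕜 (hamiltonian 𝕜 F j) (fun t x => conn M i (slicePoint a i j x t)) ↔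
      ZeroCurvatureOnSlice M i j a := by
    simp only [LiePoisson, isVelocity_hamiltonian_iff hM hF, exists_eq_left,
      coadjointMotion_conn_iff hM]
  have h2 : LiePoissonPDE 𝕜 (hamiltonian 𝕜 F j) (fun t x => conn M i (slicePoint a i j x t)) ↔
      ZeroCurvatureOnSlice M i j a := by
    simp only [LiePoissonPDE, isVelocity_hamiltonian_iff hM hF, exists_eq_left,
      zeroCurvatureOnSlice_iff, sub_eq_iff_eq_add]
  tfae_have 1 ↔ 3 := h1
  tfae_have 2 ↔ 3 := h2
  tfae_finish

theorem euler_poincare_tfae {M : ℕ → MultiTime → 𝔤} (hM : ∀ k, IsSmoothField (M k))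
    {i j : ℕ+} {F : (ℝ → Loop 𝔤) → ℕ → ℝ → 𝔤} (hF : ExpressesThrough F M j) (a : MultiTime) :
    [EulerPoincare 𝕜 (lagrangian 𝕜 F i) (fun t x => conn M j (slicePoint a i j x t)),
      EulerPoincarePDE 𝕜 (lagrangian 𝕜 F i) (fun t x => conn M j (slicePoint a i j x t)),
      ZeroCurvatureOnSlice M i j a].TFAE := by
  have h1 : EulerPoincare 𝕜 (lagrangian 𝕜 F i) (fun t x => conn M j (slicePoint a i j x t)) ↔
      ZeroCurvatureOnSlice M i j a := by
    simp only [EulerPoincare, isMomentum_lagrangian_iff hM hF, exists_eq_left,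
      coadjointMotion_conn_iff hM]
  have h2 : EulerPoincarePDE 𝕜 (lagrangian 𝕜 F i) (fun t x => conn M j (slicePoint a i j x t)) ↔
      ZeroCurvatureOnSlice M i j a := by
    simp only [EulerPoincarePDE, isMomentum_lagrangian_iff hM hF, exists_eq_left,
      zeroCurvatureOnSlice_iff]
  tfae_have 1 ↔ 3 := h1
  tfae_have 2 ↔ 3 := h2
  tfae_finish

end Variation

theorem mainTheorem3 {𝕜 𝔤 : Type*} [RCLike 𝕜] [NormedLieRing 𝔤] [NormedLieAlgebra 𝕜 𝔤]
    [NormedSpace ℝ 𝔤] [IsScalarTower ℝ 𝕜 𝔤] [FiniteDimensional 𝕜 𝔤]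
    [LieAlgebra.IsSemisimple 𝕜 𝔤]
    (M : ℕ → MultiTime → 𝔤) (hM : ∀ k, IsSmoothField (M k)) :
    (ZeroCurvature M → ∀ i, ZeroCurvatureInfty M i) ∧
    ∀ i j : ℕ+, i ≠ j →
      -- Hamiltonian formulation: `x = aᵢ`, `t = a_j`, `L = M^{(i)}`
      ((∃ F : (ℝ → Loop 𝔤) → ℕ → ℝ → 𝔤, ∀ M' : ℕ → MultiTime → 𝔤,
          (∀ k, IsSmoothField (M' k)) → VanishesAlong M' i → ZeroCurvatureInfty M' i →
          ExpressesThrough F M' i) ∧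
        ∀ F : (ℝ → Loop 𝔤) → ℕ → ℝ → 𝔤, ZeroCurvatureInfty M i → ExpressesThrough F M i →
          ∀ a : MultiTime,
            (∀ G : ℝ → ℝ → Loop 𝔤,
              IsVelocity 𝕜 (hamiltonian 𝕜 F j) (fun t x => conn M i (slicePoint a i j x t)) G ↔
                G = fun t x => conn M j (slicePoint a i j x t)) ∧
            [LiePoisson 𝕜 (hamiltonian 𝕜 F j) (fun t x => conn M i (slicePoint a i j x t)),
              LiePoissonPDE 𝕜 (hamiltonian 𝕜 F j) (fun t x => conn M i (slicePoint a i j x t)),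
              ZeroCurvatureOnSlice M i j a].TFAE) ∧
      -- Lagrangian formulation: `t = a_j`, `x = aᵢ`, with the field `M^{(j)}`
      ((∃ F : (ℝ → Loop 𝔤) → ℕ → ℝ → 𝔤, ∀ M' : ℕ → MultiTime → 𝔤,
          (∀ k, IsSmoothField (M' k)) → VanishesAlong M' j → ZeroCurvatureInfty M' j →
          ExpressesThrough F M' j) ∧
        ∀ F : (ℝ → Loop 𝔤) → ℕ → ℝ → 𝔤, ZeroCurvatureInfty M j → ExpressesThrough F M j →
          ∀ a : MultiTime,
            (∀ G : ℝ → ℝ → Loop 𝔤,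
              IsMomentum 𝕜 (lagrangian 𝕜 F i) (fun t x => conn M j (slicePoint a i j x t)) G ↔
                G = fun t x => conn M i (slicePoint a i j x t)) ∧
            [EulerPoincare 𝕜 (lagrangian 𝕜 F i) (fun t x => conn M j (slicePoint a i j x t)),
              EulerPoincarePDE 𝕜 (lagrangian 𝕜 F i) (fun t x => conn M j (slicePoint a i j x t)),
              ZeroCurvatureOnSlice M i j a].TFAE) := by
  exact ⟨ZeroCurvature.infty, fun i j _ =>
    ⟨⟨exists_expressesThrough 𝕜 i, fun _ _ hF a =>
      ⟨isVelocity_hamiltonian_iff hM hF a, lie_poisson_tfae hM hF a⟩⟩,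
    ⟨exists_expressesThrough 𝕜 j, fun _ _ hF a =>
      ⟨isMomentum_lagrangian_iff hM hF a, euler_poincare_tfae hM hF a⟩⟩⟩⟩
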